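/- **Setting.** Let $(\mathcal S,\mathcal A,\mathcal B,\sigma,p,\gamma)$ be a two-player zero-sum discounted Markov game: $\mathcal S$ (states), $\mathcal A$, $\mathcal B$ (actions of Players 1 and 2) are finite, $\sigma(s,a,b)\in[0,1]$ is the loss of Player 1, $p(\cdot\mid s,a,b)$ is a probability distribution on $\mathcal S$, and $\tfrac12\le\gamma<1$. A stationary policy of Player 1 is $x=(x^s)_{s\in\mathcal S}$ with $x^s\in\Delta_{\mathcal A}$ (the probability simplex), similarly $y=(y^s)_s$ with $y^s\in\Delta_{\mathcal B}$ for Player 2, and $$V^s_{x,y}=\mathbb E\Big[\sum_{t\ge1}\gamma^{t-1}\sigma(s_t,a_t,b_t)\Big],\qquad s_1=s,\ a_t\sim x^{s_t},\ b_t\sim y^{s_t},\ s_{t+1}\sim p(\cdot\mid s_t,a_t,b_t).$$ Norms are Euclidean and $\Pi_U$ denotes Euclidean projection onto $U$. Fix a stationary policy $y$ of Player 2, and let $\mathcal X_{BR}=\{x: V^s_{x,y}=\min_{x'}V^s_{x',y}\ \forall s\}$ and $\mathcal X_{BR}^s=\{x^s: x\in\mathcal X_{BR}\}$. **Algorithm.**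 Let $0<\eta\le 10^{-4}\sqrt{(1-\gamma)^5/|\mathcal S|}$, $\varepsilon\in[0,\frac1{1-\gamma}]$, $H=\frac2{1-\gamma}$, $\alpha_t=\frac{H+1}{H+t}$. Player 1 chooses arbitrary $\widehat x_1^s=x_1^s\in\Delta_{\mathcal A}$, sets $V_0^s=0$, and for $t=1,\dots,T$ and all $s$, with $Q_t^s(a,b)=\sigma(s,a,b)+\gamma\,\mathbb E_{s'\sim p(\cdot\mid s,a,b)}[V_{t-1}^{s'}]$, sets $$\widehat x_{t+1}^s=\Pi_{\Delta_{\mathcal A}}\{\widehat x_t^s-\eta\ell_t^s\},\quad x_{t+1}^s=\Pi_{\Delta_{\mathcal A}}\{\widehat x_{t+1}^s-\eta\ell_t^s\},\quad V_t^s=(1-\alpha_t)V_{t-1}^s+\alpha_t\rho_t^s,$$ where $\ell_t^s,\rho_t^s$ are any estimates with $\|\ell_t^s-Q_t^sy^s\|\le\varepsilon$ and $|\rho_t^s-x_t^{s\top}Q_t^sy^s|\le\varepsilon$. **Theorem.** There is a universal constant $K>0$ such that for every such game, every stationary $y$, all $\eta,\varepsilon$ as above and every execution of the algorithm the following hold.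 1. For all $T\ge2$, $$\frac1T\sum_{t=1}^T\max_{s,x'}\big(V^s_{\widehat x_t,y}-V^s_{x',y}\big)\le K\left(\frac{|\mathcal S|}{\eta(1-\gamma)^2}\sqrt{\frac{\log T}{T}}+\frac{|\mathcal S|\sqrt\varepsilon}{\sqrt\eta\,(1-\gamma)^2}\right).$$ 2. Let $Q_\star^s(a,b)=\sigma(s,a,b)+\gamma\,\mathbb E_{s'\sim p(\cdot\mid s,a,b)}[\min_{x'}V^{s'}_{x',y}]$. There exists a constant $C'>0$, depending only on the game and $y$, such that $$\max_{v'\in\Delta_{\mathcal A}}(v-v')^\top Q_\star^s y^s\ \ge\ C'\,\mathrm{dist}(v,\mathcal X_{BR}^s)\qquad\text{for all } s\in\mathcal S,\ v\in\Delta_{\mathcal A},$$ and for every such $C'$ and all $T\ge1$, the projections of the $\widehat x_T^s$ onto the sets $\mathcal X_{BR}^s$ exist, together form a policy in $\mathcal X_{BR}$, and satisfy $$\frac1{|\mathcal S|}\sum_{s\in\mathcal S}\big\|\widehat x_T^s-\Pi_{\mathcal X_{BR}^s}\{\widehat x_T^s\}\big\|^2\le K\left(\frac{|\mathcal S|^2}{\eta^4C'^4(1-\gamma)^4T}+\frac{\varepsilon}{\eta\,C'^2(1-\gamma)^3}\right).$$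 -/

import Mathlib

open MeasureTheory ProbabilityTheory Matrix

universe u v w

noncomputable section

namespace ZeroSum

/-- The probability simplex over a finite set, inside Euclidean space (so that `‖·‖` is the
`L₂` norm). -/
def simplex (ι : Type*) [Fintype ι] : Set (EuclideanSpace ℝ ι) :=
  {v | v.ofLp ∈ stdSimplex ℝ ι}

/-- `u` is the Euclidean projection of `v` onto the set `U`: a point of `U` nearest to `v`. -/
def IsProj {E : Type*} [NormedAddCommGroup E] (U : Set E) (v u : E) : Prop :=
  u ∈ U ∧ ∀ w ∈ U, ‖u - v‖ ≤ ‖w - v‖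

/-- A two-player zero-sum discounted Markov game with state set `S` and action sets `A`, `B`. -/
structure MarkovGame (S : Type u) (A : Type v) (B : Type w) [Fintype S] where
  /-- The loss of Player 1, which is the payoff of Player 2. -/
  loss : S → A → B → ℝ
  loss_mem : ∀ s a b, loss s a b ∈ Set.Icc (0 : ℝ) 1
  /-- `trans s a b s'` is the probability of moving from `s` to `s'` under actions `a`, `b`. -/
  trans : S → A → B → simplex S
  /-- The discount factor. -/
  γ : ℝ
  γ_mem : γ ∈ Set.Ico (1 / 2 : ℝ) 1

/-- A stationary policy: a distribution over actions for every state. -/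
abbrev Policy (S : Type*) (A : Type*) [Fintype A] := S → simplex A

/-- One time step of a play: the current state and the two actions taken there. -/
structure Step (S : Type u) (A : Type v) (B : Type w) where
  state : S
  act₁ : A
  act₂ : B

instance (S : Type u) (A : Type v) (B : Type w) : MeasurableSpace (Step S A B) := ⊤

instance (S : Type u) (A : Type v) (B : Type w) : DiscreteMeasurableSpace (Step S A B) :=
  ⟨fun _ => trivial⟩

variable {S : Type u} {A : Type v} {B : Type w} [Fintype S] [Fintype A] [Fintype B]

/-- The law of the step taken at state `s`: `a ∼ x^s` and `b ∼ y^s` independently. -/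
def stepLaw (x : Policy S A) (y : Policy S B) (s : S) : Measure (Step S A B) :=
  ∑ a, ∑ b, ENNReal.ofReal ((x s).1 a * (y s).1 b) • Measure.dirac ⟨s, a, b⟩

instance (x : Policy S A) (y : Policy S B) (s : S) : IsProbabilityMeasure (stepLaw x y s) := by
  constructor
  have hx := (x s).2
  have hy := (y s).2
  simp only [simplex, Set.mem_ofPred_eq, stdSimplex] at hx hy
  have h : ∀ a b, 0 ≤ (x s).1 a * (y s).1 b := fun a b => mul_nonneg (hx.1 a) (hy.1 b)
  simp only [stepLaw, Measure.finsetSum_apply, Measure.smul_apply, measure_univ, smul_eq_mul,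
    mul_one]
  simp_rw [← ENNReal.ofReal_sum_of_nonneg (fun b _ => h _ b)]
  rw [← ENNReal.ofReal_sum_of_nonneg (fun a _ => Finset.sum_nonneg fun b _ => h a b)]
  simp_rw [← Finset.mul_sum]
  rw [hy.2, ← Finset.sum_mul, hx.2]
  simp

namespace MarkovGame

variable (G : MarkovGame S A B)

/-- The law of the next step after the step `q`: `s' ∼ p(· | s, a, b)`, then `a' ∼ x^{s'}` and
`b' ∼ y^{s'}`. -/
def nextLaw (x : Policy S A) (y : Policy S B) (q : Step S A B) : Measure (Step S A B) :=
  ∑ s', ENNReal.ofReal ((G.trans q.state q.act₁ q.act₂).1 s') • stepLaw x y s'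

/-- The Markov kernel `q ↦ nextLaw q`. -/
def nextKernel (x : Policy S A) (y : Policy S B) : Kernel (Step S A B) (Step S A B) where
  toFun := G.nextLaw x y
  measurable' := measurable_from_top

instance (x : Policy S A) (y : Policy S B) : IsMarkovKernel (G.nextKernel x y) := by
  constructor
  intro q
  constructor
  have hp := (G.trans q.state q.act₁ q.act₂).2
  simp only [simplex, Set.mem_ofPred_eq, stdSimplex] at hp
  change G.nextLaw x y q Set.univ = 1
  simp only [nextLaw, Measure.finsetSum_apply, Measure.smul_apply, measure_univ, smul_eq_mul,
    mul_one]
  rw [← ENNReal.ofReal_sum_of_nonneg (fun a _ => hp.1 a), hp.2]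
  simp

/-- The kernel giving step `n + 1` from the history up to step `n`; it only looks at step `n`. -/
def historyKernel (x : Policy S A) (y : Policy S B) (n : ℕ) :
    Kernel (Π _ : Finset.Iic n, Step S A B) (Step S A B) :=
  (G.nextKernel x y).comap (fun h => h ⟨n, Finset.mem_Iic.2 le_rfl⟩) (measurable_pi_apply _)

instance (x : Policy S A) (y : Policy S B) (n : ℕ) : IsMarkovKernel (G.historyKernel x y n) := by
  unfold historyKernel
  infer_instance

/-- The law of the infinite play started at `s` when the players use `x` and `y`. -/
def playLaw (x : Policy S A) (y : Policy S B) (s : S) : Measure (ℕ → Step S A B) :=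
  Kernel.trajMeasure (X := fun _ => Step S A B) (stepLaw x y s) (G.historyKernel x y)

/-- The value `V^s_{x,y}`: the expected discounted total loss. -/
def value (x : Policy S A) (y : Policy S B) (s : S) : ℝ :=
  ∫ ω, ∑' t : ℕ, G.γ ^ t * G.loss (ω t).state (ω t).act₁ (ω t).act₂ ∂(G.playLaw x y s)

/-- The matrix `Q(a,b) = σ(s,a,b) + γ 𝔼_{s' ∼ p(·|s,a,b)}[V^{s'}]` for a vector `V` of
state values. -/
def qMatrix (V : S → ℝ) (s : S) : Matrix A B ℝ :=
  Matrix.of fun a b => G.loss s a b + G.γ * ∑ s', (G.trans s a b).1 s' * V s'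

/-- The set of best responses to `y`: policies attaining `min_{x'} V^s_{x',y}` at every state. -/
def bestResponses (y : Policy S B) : Set (Policy S A) :=
  {x | ∀ s, ∀ x' : Policy S A, G.value x y s ≤ G.value x' y s}

/-- The action distributions which best responses to `y` use at the state `s`. -/
def bestResponsesAt (y : Policy S B) (s : S) : Set (EuclideanSpace ℝ A) :=
  {v | ∃ x ∈ G.bestResponses y, (x s).1 = v}

/-- The value `min_{x'} V^s_{x',y}` of best responding to `y`. -/
def bestValue (y : Policy S B) (s : S) : ℝ := ⨅ x' : Policy S A, G.value x' y s

/-- `C` satisfies, for all states `s` and all `x^s` in the simplex,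
`max_{x'} (x^s - x'^s)ᵀ Q⋆^s y^s ≥ C * dist(x^s, X_BR^s)`, where `Q⋆` is the matrix of the best
response values. It is the error-bound constant of the game in which the opponent is frozen to `y`;
it depends on nothing but the game and `y`. -/
def IsErrorBoundConst (y : Policy S B) (C : ℝ) : Prop :=
  ∀ (s : S) (v : simplex A),
    C * Metric.infDist v.1 (G.bestResponsesAt y s) ≤
      ⨆ v' : simplex A,
        (v.1.ofLp ⬝ᵥ (G.qMatrix (G.bestValue y) s *ᵥ (y s).1.ofLp) -
          v'.1.ofLp ⬝ᵥ (G.qMatrix (G.bestValue y) s *ᵥ (y s).1.ofLp))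

/-- The critic's learning rate `α_t = (H + 1) / (H + t)` with `H = 2 / (1 - γ)`. -/
def rate (t : ℕ) : ℝ := (2 / (1 - G.γ) + 1) / (2 / (1 - G.γ) + t)

/-- An execution of `T` iterations (`t = 1, …, T`) of optimistic gradient descent with a slow critic
by Player 1, while Player 2 plays the stationary policy `y`. The estimates `ℓ` and `ρ` are arbitrary
up to accuracy `ε`. Entries with index `0` (other than `V 0`) or index beyond `T + 1` play no role. -/
structure SinglePlayerRun (y : Policy S B) (η ε : ℝ) (T : ℕ) where
  η_pos : 0 < η
  η_le : η ≤ 1 / 10 ^ 4 * √((1 - G.γ) ^ 5 / (Fintype.card S : ℝ))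
  ε_nonneg : 0 ≤ ε
  ε_le : ε ≤ 1 / (1 - G.γ)
  /-- The iterates `x̂_t`. -/
  xhat : ℕ → Policy S A
  /-- The iterates `x_t`. -/
  x : ℕ → Policy S A
  /-- The critic's values `V_t`. -/
  V : ℕ → S → ℝ
  /-- The loss estimates `ℓ_t`. -/
  l : ℕ → S → EuclideanSpace ℝ A
  /-- The value estimates `ρ_t`. -/
  ρ : ℕ → S → ℝ
  x_init : xhat 1 = x 1
  V_init : ∀ s, V 0 s = 0
  l_approx : ∀ t ∈ Finset.Icc 1 T, ∀ s,
    ‖l t s - WithLp.toLp 2 (G.qMatrix (V (t - 1)) s *ᵥ (y s).1.ofLp)‖ ≤ ε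
  ρ_approx : ∀ t ∈ Finset.Icc 1 T, ∀ s,
    |ρ t s - (x t s).1.ofLp ⬝ᵥ (G.qMatrix (V (t - 1)) s *ᵥ (y s).1.ofLp)| ≤ ε
  xhat_update : ∀ t ∈ Finset.Icc 1 T, ∀ s,
    IsProj (simplex A) ((xhat t s).1 - η • l t s) (xhat (t + 1) s).1
  x_update : ∀ t ∈ Finset.Icc 1 T, ∀ s,
    IsProj (simplex A) ((xhat (t + 1) s).1 - η • l t s) (x (t + 1) s).1
  V_update : ∀ t ∈ Finset.Icc 1 T, ∀ s,
    V t s = (1 - G.rate t) * V (t - 1) s + G.rate t * ρ t s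

end MarkovGame

end ZeroSum

end

/-!
Up to the prediction error, one step of optimistic gradient descent has regret
`(‖x̂_t - x⋆‖² - ‖x̂_{t+1} - x⋆‖²) / (2 η)` against every best response `x⋆`, and since the critic
moves by at most its learning rate `α_t`, the prediction error is of order `α_t / η + ε`. Averaging
this regret with the weights of the critic shows that the potential
`V_t - V⋆ + α_t ‖x̂_{t+1} - x⋆‖² / (2 η)` is of order `1 / (η (1 - γ)² t) + ε / (1 - γ)`; the lower
bound on `V_t - V⋆` is easier because no policy beats a best response. So the losses driving the
descent are close to `Q_⋆ y`, and the suboptimality of `x̂_{t+1}` with respect to `Q_⋆ y` is at most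
`(‖x̂_t - x⋆‖² - ‖x̂_{t+1} - x⋆‖²) / (2 η)` plus the error of the critic.

Summing over `t` telescopes the distances and leaves a harmonic sum, which bounds the average
suboptimality. For the last iterate, take for `x⋆` the best response nearest to `x̂_t`: since the
suboptimality is at least `C'` times the distance to the best responses, the squared distance
contracts by the factor `1 + η C'` per step, up to a perturbation of order `1 / t + η ε`. The
error bound itself is Hoffman's: at every state the suboptimality is linear on the simplex and
vanishes exactly on the face of optimal actions.
-/

noncomputable section

namespace ZeroSum

variable {S : Type u} {A : Type v} {B : Type w}

/-! ### Plays and values -/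

section Trajectories

variable {X : ℕ → Type*} [∀ n, MeasurableSpace (X n)] (μ₀ : Measure (X 0))
  (κ : (n : ℕ) → Kernel (Π i : Finset.Iic n, X i) (X (n + 1))) [∀ n, IsMarkovKernel (κ n)]

lemma map_eval_zero_trajMeasure :
    (Kernel.trajMeasure μ₀ κ).map (fun ω => ω 0) = μ₀ := by
  let eval₀ : (Π i : Finset.Iic 0, X i) → X 0 := fun h => h ⟨0, Finset.mem_Iic.2 le_rfl⟩
  let const : X 0 → Π i : Finset.Iic 0, X i :=
    (MeasurableEquiv.piUnique fun i : Finset.Iic 0 => X i).symm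
  have hcomp : (fun ω : Π n, X n => ω 0) = eval₀ ∘ Preorder.frestrictLe 0 := rfl
  have hmap : (Kernel.trajMeasure μ₀ κ).map (Preorder.frestrictLe 0) = μ₀.map const := by
    rw [Kernel.trajMeasure, Measure.map_comp _ _ (by fun_prop), Kernel.traj_map_frestrictLe,
      Kernel.partialTraj_self, Measure.id_comp]
    rfl
  have heval : Measurable eval₀ := measurable_pi_apply _
  have hconst : Measurable const := (MeasurableEquiv.piUnique _).symm.measurable
  have hid : eval₀ ∘ const = id := rfl
  rw [hcomp, ← Measure.map_map heval (by fun_prop), hmap, Measure.map_map heval hconst, hid,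
    Measure.map_id]

lemma map_eval_succ_trajMeasure [IsProbabilityMeasure μ₀] (n : ℕ) :
    (Kernel.trajMeasure μ₀ κ).map (fun ω => ω (n + 1)) =
      κ n ∘ₘ (Kernel.trajMeasure μ₀ κ).map (Preorder.frestrictLe n) := by
  rw [← Measure.snd_compProd, Kernel.map_frestrictLe_trajMeasure_compProd_eq_map_trajMeasure,
    Measure.snd, Measure.map_map (by fun_prop) (by fun_prop)]
  rfl

end Trajectories

instance [Finite S] [Finite A] [Finite B] : Finite (Step S A B) :=
  Finite.of_injective (fun q : Step S A B => (q.state, q.act₁, q.act₂)) <| by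
    rintro ⟨⟩ ⟨⟩ h
    simpa using h

lemma integral_stepLaw [Fintype A] [Fintype B] (x : Policy S A) (y : Policy S B) (s : S)
    (f : Step S A B → ℝ) :
    ∫ q, f q ∂(stepLaw x y s) = ∑ a, ∑ b, (x s).1 a * (y s).1 b * f ⟨s, a, b⟩ := by
  have hf (a : A) (b : B) : Integrable f
      (ENNReal.ofReal ((x s).1 a * (y s).1 b) • Measure.dirac (⟨s, a, b⟩ : Step S A B)) :=
    (integrable_dirac (by simp)).smul_measure ENNReal.ofReal_ne_top
  rw [stepLaw, integral_finsetSum_measure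
    (fun a _ => integrable_finsetSum_measure.2 fun b _ => hf a b)]
  refine Finset.sum_congr rfl fun a _ => ?_
  rw [integral_finsetSum_measure (fun b _ => hf a b)]
  refine Finset.sum_congr rfl fun b _ => ?_
  rw [integral_smul_measure, integral_dirac,
    ENNReal.toReal_ofReal (mul_nonneg ((x s).2.1 a) ((y s).2.1 b)), smul_eq_mul]

namespace MarkovGame

section Loss

variable [Fintype S] (G : MarkovGame S A B)

lemma γ_nonneg : 0 ≤ G.γ := by linarith [G.γ_mem.1]

lemma γ_lt_one : G.γ < 1 := G.γ_mem.2

lemma one_sub_γ_pos : 0 < 1 - G.γ := sub_pos.2 G.γ_lt_one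

lemma hasSum_γ_pow : HasSum (fun n => G.γ ^ n) (1 / (1 - G.γ)) := by
  simpa only [one_div] using hasSum_geometric_of_lt_one G.γ_nonneg G.γ_lt_one

lemma measurable_loss_eval [Finite A] [Finite B] (n : ℕ) :
    Measurable fun ω : ℕ → Step S A B => G.loss (ω n).state (ω n).act₁ (ω n).act₂ :=
  (Measurable.of_discrete (f := fun q : Step S A B => G.loss q.state q.act₁ q.act₂)).comp
    (measurable_pi_apply n)

end Loss

variable [Fintype S] [Fintype A] [Fintype B]
  (G : MarkovGame S A B) (x : Policy S A) (y : Policy S B)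

lemma integral_nextKernel (q : Step S A B) (f : Step S A B → ℝ) :
    ∫ r, f r ∂(G.nextKernel x y q) =
      ∑ s', (G.trans q.state q.act₁ q.act₂).1 s' * ∫ r, f r ∂(stepLaw x y s') := by
  change ∫ r, f r ∂(G.nextLaw x y q) = _
  rw [nextLaw, integral_finsetSum_measure
    (fun s' _ => Integrable.of_finite.smul_measure ENNReal.ofReal_ne_top)]
  refine Finset.sum_congr rfl fun s' _ => ?_
  rw [integral_smul_measure,
    ENNReal.toReal_ofReal ((G.trans q.state q.act₁ q.act₂).2.1 s'), smul_eq_mul]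

instance (s : S) : IsProbabilityMeasure (G.playLaw x y s) := by
  unfold playLaw
  infer_instance

lemma map_eval_zero_playLaw (s : S) :
    (G.playLaw x y s).map (fun ω => ω 0) = stepLaw x y s :=
  map_eval_zero_trajMeasure (X := fun _ => Step S A B) _ _

lemma map_eval_succ_playLaw (s : S) (n : ℕ) :
    (G.playLaw x y s).map (fun ω => ω (n + 1)) =
      G.nextKernel x y ∘ₘ (G.playLaw x y s).map (fun ω => ω n) := by
  have hcomp : (fun ω : ℕ → Step S A B => ω n) =
      (fun h : (Π _ : Finset.Iic n, Step S A B) => h ⟨n, Finset.mem_Iic.2 le_rfl⟩) ∘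
        Preorder.frestrictLe n := rfl
  have hsucc := map_eval_succ_trajMeasure (X := fun _ => Step S A B) (stepLaw x y s)
    (G.historyKernel x y) n
  rw [hcomp, ← Measure.map_map (by fun_prop) (by fun_prop), playLaw, hsucc, historyKernel,
    ← Kernel.comp_deterministic_eq_comap, ← Measure.comp_assoc,
    Measure.deterministic_comp_eq_map]

lemma integral_eval_zero_playLaw (s : S) (f : Step S A B → ℝ) :
    ∫ ω, f (ω 0) ∂(G.playLaw x y s) = ∑ a, ∑ b, (x s).1 a * (y s).1 b * f ⟨s, a, b⟩ := by
  rw [← integral_stepLaw, ← G.map_eval_zero_playLaw x y s, integral_map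
    (measurable_pi_apply 0).aemeasurable Measurable.of_discrete.aestronglyMeasurable]

lemma integral_eval_succ_playLaw (s : S) (n : ℕ) (f : Step S A B → ℝ) :
    ∫ ω, f (ω (n + 1)) ∂(G.playLaw x y s) =
      ∫ ω, (∫ r, f r ∂(G.nextKernel x y (ω n))) ∂(G.playLaw x y s) := by
  have hmeas (k : ℕ) : AEMeasurable (fun ω : ℕ → Step S A B => ω k) (G.playLaw x y s) :=
    (measurable_pi_apply k).aemeasurable
  have := Measure.isProbabilityMeasure_map (hmeas n)
  rw [← integral_map (hmeas (n + 1)) Measurable.of_discrete.aestronglyMeasurable,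
    map_eval_succ_playLaw, Measure.comp_eq_comp_const_apply,
    Kernel.integral_comp Integrable.of_finite, Kernel.const_apply,
    integral_map (hmeas n) Measurable.of_discrete.aestronglyMeasurable]

/-- The expected loss of the `n`-th step, counted from `0`, of the play started at `s`. -/
def expectedLoss (n : ℕ) (s : S) : ℝ :=
  ∫ ω, G.loss (ω n).state (ω n).act₁ (ω n).act₂ ∂(G.playLaw x y s)

/- `integral_eval_succ_playLaw` conditions on the last step of the play, while this recursion
conditions on the first one: only the latter yields the Bellman equation. -/
lemma integral_eval_succ_playLaw_eq_sum (s : S) (n : ℕ) (f : Step S A B → ℝ) :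
    ∫ ω, f (ω (n + 1)) ∂(G.playLaw x y s) =
      ∑ a, ∑ b, (x s).1 a * (y s).1 b *
        ∑ s', (G.trans s a b).1 s' * ∫ ω, f (ω n) ∂(G.playLaw x y s') := by
  induction n generalizing f with
  | zero =>
    rw [integral_eval_succ_playLaw,
      G.integral_eval_zero_playLaw x y s fun q => ∫ r, f r ∂(G.nextKernel x y q)]
    simp_rw [integral_nextKernel, integral_stepLaw, integral_eval_zero_playLaw]
  | succ n ih =>
    rw [integral_eval_succ_playLaw, ih fun q => ∫ r, f r ∂(G.nextKernel x y q)]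
    simp_rw [← integral_eval_succ_playLaw]

lemma expectedLoss_zero (s : S) :
    G.expectedLoss x y 0 s = ∑ a, ∑ b, (x s).1 a * (y s).1 b * G.loss s a b :=
  G.integral_eval_zero_playLaw x y s fun q => G.loss q.state q.act₁ q.act₂

lemma expectedLoss_succ (n : ℕ) (s : S) :
    G.expectedLoss x y (n + 1) s = ∑ a, ∑ b, (x s).1 a * (y s).1 b *
      ∑ s', (G.trans s a b).1 s' * G.expectedLoss x y n s' :=
  G.integral_eval_succ_playLaw_eq_sum x y s n fun q => G.loss q.state q.act₁ q.act₂

lemma expectedLoss_nonneg (n : ℕ) (s : S) : 0 ≤ G.expectedLoss x y n s :=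
  integral_nonneg fun _ => (G.loss_mem _ _ _).1

lemma expectedLoss_le_one (n : ℕ) (s : S) : G.expectedLoss x y n s ≤ 1 := by
  refine (integral_mono_of_nonneg (.of_forall fun _ => (G.loss_mem _ _ _).1)
    (integrable_const (1 : ℝ)) (.of_forall fun _ => (G.loss_mem _ _ _).2)).trans_eq ?_
  simp

lemma hasSum_value (s : S) :
    HasSum (fun n => G.γ ^ n * G.expectedLoss x y n s) (G.value x y s) := by
  have hbound (n : ℕ) (ω : ℕ → Step S A B) :
      ‖G.γ ^ n * G.loss (ω n).state (ω n).act₁ (ω n).act₂‖ ≤ G.γ ^ n := by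
    obtain ⟨hnonneg, hle⟩ := G.loss_mem (ω n).state (ω n).act₁ (ω n).act₂
    have hγn := pow_nonneg G.γ_nonneg n
    rw [Real.norm_of_nonneg (mul_nonneg hγn hnonneg)]
    exact mul_le_of_le_one_right hγn hle
  have hsum : Summable fun n => G.γ ^ n := G.hasSum_γ_pow.summable
  simp_rw [expectedLoss, ← integral_const_mul]
  exact hasSum_integral_of_dominated_convergence (fun n _ => G.γ ^ n)
    (fun n => ((G.measurable_loss_eval n).const_mul _).aestronglyMeasurable)
    (fun n => .of_forall (hbound n)) (.of_forall fun _ => hsum) (integrable_const _)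
    (.of_forall fun ω => (Summable.of_norm_bounded hsum fun n => hbound n ω).hasSum)

lemma value_nonneg (s : S) : 0 ≤ G.value x y s :=
  (G.hasSum_value x y s).nonneg fun n =>
    mul_nonneg (pow_nonneg G.γ_nonneg n) (G.expectedLoss_nonneg x y n s)

lemma value_le (s : S) : G.value x y s ≤ 1 / (1 - G.γ) :=
  hasSum_le (fun n => mul_le_of_le_one_right (pow_nonneg G.γ_nonneg n)
    (G.expectedLoss_le_one x y n s)) (G.hasSum_value x y s) G.hasSum_γ_pow

theorem value_eq_dotProduct_qMatrix (s : S) :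
    G.value x y s = (x s).1.ofLp ⬝ᵥ (G.qMatrix (G.value x y) s *ᵥ (y s).1.ofLp) := by
  have htail : HasSum (fun n => G.γ ^ (n + 1) * G.expectedLoss x y (n + 1) s)
      (∑ a, ∑ b, (x s).1 a * (y s).1 b *
        ∑ s', (G.trans s a b).1 s' * (G.γ * G.value x y s')) := by
    have hterm (n : ℕ) : G.γ ^ (n + 1) * G.expectedLoss x y (n + 1) s =
        ∑ a, ∑ b, (x s).1 a * (y s).1 b *
          ∑ s', (G.trans s a b).1 s' * (G.γ * (G.γ ^ n * G.expectedLoss x y n s')) := by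
      simp only [expectedLoss_succ, Finset.mul_sum]
      congr! 3
      ring
    simp_rw [hterm]
    exact hasSum_sum fun a _ => hasSum_sum fun b _ => HasSum.mul_left _ <| hasSum_sum fun s' _ =>
      ((G.hasSum_value x y s').mul_left _).mul_left _
  have hhead := (G.hasSum_value x y s).unique htail.zero_add
  rw [pow_zero, one_mul, expectedLoss_zero] at hhead
  rw [hhead, ← Finset.sum_add_distrib]
  simp only [dotProduct, mulVec, qMatrix, Matrix.of_apply, Finset.mul_sum,
    ← Finset.sum_add_distrib]
  congr! 2
  simp only [mul_add, add_mul, Finset.mul_sum, Finset.sum_mul]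
  congr! 1
  · ring
  · congr! 1
    ring

end MarkovGame

/-! ### The simplex and projected gradient steps -/

section Simplex

variable {ι : Type*} [Fintype ι] {v w : EuclideanSpace ℝ ι} {f g : ι → ℝ} {c : ℝ}

lemma nonempty_of_mem_simplex (hv : v ∈ simplex ι) : Nonempty ι := by
  by_contra hempty
  rw [not_nonempty_iff] at hempty
  simpa using hv.2

lemma convex_simplex : Convex ℝ (simplex ι) :=
  (convex_stdSimplex ℝ ι).linear_preimage (WithLp.linearEquiv 2 ℝ (ι → ℝ)).toLinearMap

lemma isCompact_simplex : IsCompact (simplex ι) :=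
  (PiLp.homeomorph 2 fun _ : ι => ℝ).isCompact_preimage.2 (isCompact_stdSimplex ℝ ι)

lemma single_mem_simplex [DecidableEq ι] (i : ι) : EuclideanSpace.single i 1 ∈ simplex ι :=
  single_mem_stdSimplex ℝ i

lemma single_dotProduct_eq_apply [DecidableEq ι] (i : ι) (f : ι → ℝ) :
    (EuclideanSpace.single i (1 : ℝ)).ofLp ⬝ᵥ f = f i :=
  single_one_dotProduct i f

lemma sum_smul_single_one [DecidableEq ι] (v : EuclideanSpace ℝ ι) :
    ∑ i, v.ofLp i • EuclideanSpace.single i (1 : ℝ) = v := by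
  ext j
  simp [WithLp.ofLp_sum, Pi.single_apply]

lemma inner_toLp (v : EuclideanSpace ℝ ι) (f : ι → ℝ) :
    inner ℝ v (WithLp.toLp 2 f) = v.ofLp ⬝ᵥ f := by
  rw [EuclideanSpace.inner_eq_star_dotProduct]
  simp [dotProduct_comm]

lemma continuous_ofLp_dotProduct (f : ι → ℝ) :
    Continuous fun v : EuclideanSpace ℝ ι => v.ofLp ⬝ᵥ f := by
  unfold dotProduct
  fun_prop

lemma dotProduct_const_of_mem_simplex (hv : v ∈ simplex ι) (c : ℝ) :
    (v.ofLp ⬝ᵥ fun _ => c) = c := by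
  rw [dotProduct, ← Finset.sum_mul, hv.2, one_mul]

lemma dotProduct_mono_of_mem_simplex (hv : v ∈ simplex ι) (h : ∀ i, f i ≤ g i) :
    v.ofLp ⬝ᵥ f ≤ v.ofLp ⬝ᵥ g :=
  Finset.sum_le_sum fun i _ => mul_le_mul_of_nonneg_left (h i) (hv.1 i)

lemma dotProduct_le_of_mem_simplex (hv : v ∈ simplex ι) (h : ∀ i, f i ≤ c) : v.ofLp ⬝ᵥ f ≤ c :=
  (dotProduct_mono_of_mem_simplex hv h).trans_eq (dotProduct_const_of_mem_simplex hv c)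

lemma le_dotProduct_of_mem_simplex (hv : v ∈ simplex ι) (h : ∀ i, c ≤ f i) : c ≤ v.ofLp ⬝ᵥ f :=
  (dotProduct_const_of_mem_simplex hv c).symm.trans_le (dotProduct_mono_of_mem_simplex hv h)

lemma dotProduct_le_dotProduct_add_of_mem_simplex (hv : v ∈ simplex ι) (h : ∀ i, f i ≤ g i + c) :
    v.ofLp ⬝ᵥ f ≤ v.ofLp ⬝ᵥ g + c := by
  rw [← sub_le_iff_le_add', ← dotProduct_sub]
  exact dotProduct_le_of_mem_simplex hv fun i => sub_le_iff_le_add'.2 (h i)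

lemma abs_dotProduct_le_of_mem_simplex (hv : v ∈ simplex ι) (h : ∀ i, |f i| ≤ c) :
    |v.ofLp ⬝ᵥ f| ≤ c :=
  abs_le.2 ⟨le_dotProduct_of_mem_simplex hv fun i => (abs_le.1 (h i)).1,
    dotProduct_le_of_mem_simplex hv fun i => (abs_le.1 (h i)).2⟩

lemma dotProduct_sub_le_of_mem_simplex (hv : v ∈ simplex ι) (hw : w ∈ simplex ι)
    (h : ∀ i, |f i - g i| ≤ c) :
    v.ofLp ⬝ᵥ f - w.ofLp ⬝ᵥ f ≤ v.ofLp ⬝ᵥ g - w.ofLp ⬝ᵥ g + 2 * c := by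
  have hfg := abs_le.1 (abs_dotProduct_le_of_mem_simplex (f := f - g) hv h)
  have hfg' := abs_le.1 (abs_dotProduct_le_of_mem_simplex (f := f - g) hw h)
  simp only [dotProduct_sub] at hfg hfg'
  linarith [hfg.2, hfg'.1]

lemma norm_sub_sq_le_two (hv : v ∈ simplex ι) (hw : w ∈ simplex ι) : ‖v - w‖ ^ 2 ≤ 2 := by
  have hle_one {u : EuclideanSpace ℝ ι} (hu : u ∈ simplex ι) (i : ι) : u.ofLp i ≤ 1 :=
    hu.2 ▸ Finset.single_le_sum (fun j _ => hu.1 j) (Finset.mem_univ i)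
  calc ‖v - w‖ ^ 2 = ∑ i, (v.ofLp i - w.ofLp i) ^ 2 := by
        simp [EuclideanSpace.norm_sq_eq]
    _ ≤ ∑ i, (v.ofLp i + w.ofLp i) := Finset.sum_le_sum fun i _ => by
        nlinarith [hle_one hv i, hle_one hw i, hv.1 i, hw.1 i, mul_nonneg (hv.1 i) (hw.1 i)]
    _ = 2 := by rw [Finset.sum_add_distrib, hv.2, hw.2, one_add_one_eq_two]

lemma norm_sub_le_two (hv : v ∈ simplex ι) (hw : w ∈ simplex ι) : ‖v - w‖ ≤ 2 := by
  nlinarith [norm_sub_sq_le_two hv hw, norm_nonneg (v - w)]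

end Simplex

namespace IsProj

section InfDist

variable {E : Type*} [NormedAddCommGroup E] {U : Set E} {u v : E}

lemma norm_sub_eq_infDist (h : IsProj U v u) : ‖v - u‖ = Metric.infDist v U := by
  refine le_antisymm ((Metric.le_infDist ⟨u, h.1⟩).2 fun w hw => ?_) ?_
  · rw [dist_eq_norm, norm_sub_rev v u, norm_sub_rev v w]
    exact h.2 w hw
  · rw [← dist_eq_norm]
    exact Metric.infDist_le_dist_of_mem h.1

lemma exists_of_isCompact (hU : IsCompact U) (hne : U.Nonempty) (v : E) : ∃ u, IsProj U v u := by
  obtain ⟨u, hu, hdist⟩ := hU.exists_infDist_eq_dist hne v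
  refine ⟨u, hu, fun w hw => ?_⟩
  rw [← dist_eq_norm, ← dist_eq_norm, dist_comm, ← hdist, dist_comm]
  exact Metric.infDist_le_dist_of_mem hw

end InfDist

variable {E : Type*} [NormedAddCommGroup E] [InnerProductSpace ℝ E] {U : Set E}
  {u v w x l m : E} {η : ℝ}

lemma inner_sub_le_zero (hU : Convex ℝ U) (h : IsProj U v u) (hw : w ∈ U) :
    inner ℝ (v - u) (w - u) ≤ 0 := by
  have : Nonempty U := ⟨⟨u, h.1⟩⟩
  refine (norm_eq_iInf_iff_real_inner_le_zero hU h.1).1 (le_antisymm (le_ciInf fun z => ?_)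
    (ciInf_le (f := fun z : U => ‖v - z‖) ⟨0, ?_⟩ ⟨u, h.1⟩)) w hw
  · rw [norm_sub_rev, norm_sub_rev _ (z : E)]
    exact h.2 z z.2
  · rintro _ ⟨z, rfl⟩
    exact norm_nonneg _

lemma two_mul_inner_le (hU : Convex ℝ U) (h : IsProj U (v - η • l) u) (hw : w ∈ U) :
    2 * η * inner ℝ (u - w) l ≤ ‖v - w‖ ^ 2 - ‖u - w‖ ^ 2 - ‖u - v‖ ^ 2 := by
  have hobtuse := h.inner_sub_le_zero hU hw
  have hexpand : ‖v - w‖ ^ 2 = ‖u - v‖ ^ 2 + ‖u - w‖ ^ 2 - 2 * inner ℝ (v - u) (w - u) := by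
    rw [← sub_sub_sub_cancel_right v w u, norm_sub_sq_real, norm_sub_rev v u, norm_sub_rev w u]
    ring
  have hsplit : inner ℝ (v - η • l - u) (w - u) =
      inner ℝ (v - u) (w - u) + η * inner ℝ (u - w) l := by
    rw [sub_right_comm, inner_sub_left, real_inner_smul_left, real_inner_comm (w - u) l,
      ← neg_sub w u, inner_neg_left]
    ring
  linarith

/- The descent inequality for `x` costs `‖x - u‖² + ‖x - v‖²`, which the one for `u` pays back, so
that only the error of the prediction `m` of `l` remains. -/
lemma two_mul_inner_le_of_prediction (hU : Convex ℝ U) (hu : IsProj U (v - η • l) u)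
    (hx : IsProj U (v - η • m) x) (hw : w ∈ U) :
    2 * η * inner ℝ (x - w) l ≤
      ‖v - w‖ ^ 2 - ‖u - w‖ ^ 2 + 2 * η * inner ℝ (x - u) (l - m) := by
  have hul := hu.two_mul_inner_le hU hw
  have hxm := hx.two_mul_inner_le hU hu.1
  have hsplit : inner ℝ (x - w) l =
      inner ℝ (u - w) l + inner ℝ (x - u) m + inner ℝ (x - u) (l - m) := by
    rw [inner_sub_right, ← sub_add_sub_cancel x u w, inner_add_left]
    ring
  rw [norm_sub_rev v u] at hxm
  rw [hsplit]
  nlinarith [sq_nonneg ‖x - u‖, sq_nonneg ‖x - v‖]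

end IsProj

/-! ### Best responses to a stationary policy -/

lemma le_div_one_sub_of_forall_bound {ι : Type*} [Finite ι] {γ g : ℝ} (hγ : γ < 1) {D : ι → ℝ}
    (h : ∀ M, (∀ i, D i ≤ M) → ∀ i, D i ≤ γ * M + g) (i : ι) : D i ≤ g / (1 - γ) := by
  have : Nonempty ι := ⟨i⟩
  obtain ⟨j, hj⟩ := Finite.exists_max D
  refine (hj i).trans ?_
  rw [le_div_iff₀ (sub_pos.2 hγ)]
  linarith [h (D j) hj j]

namespace MarkovGame

variable [Fintype S]

section ActionValue

variable [Fintype B] (G : MarkovGame S A B) (y : Policy S B)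

/-- The expected losses of the actions of Player 1 at `s` against `y` when the continuation values
are `V`. For `V = V_{t-1}` this is the vector `Q_t^s y^s` of the algorithm, for the best-response
values it is `Q_⋆^s y^s`. -/
def actionValue (V : S → ℝ) (s : S) : A → ℝ := G.qMatrix V s *ᵥ (y s).1.ofLp

variable {V W : S → ℝ} {M : ℝ}

lemma actionValue_apply (V : S → ℝ) (s : S) (a : A) : G.actionValue y V s a =
    (y s).1.ofLp ⬝ᵥ (fun b => G.loss s a b + G.γ * ((G.trans s a b).1.ofLp ⬝ᵥ V)) :=
  Finset.sum_congr rfl fun _ _ => mul_comm _ _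

lemma actionValue_le_add (h : ∀ s, V s ≤ W s + M) (s : S) (a : A) :
    G.actionValue y V s a ≤ G.actionValue y W s a + G.γ * M := by
  rw [actionValue_apply, actionValue_apply]
  refine dotProduct_le_dotProduct_add_of_mem_simplex (y s).2 fun b => ?_
  have htrans := dotProduct_le_dotProduct_add_of_mem_simplex (G.trans s a b).2 h
  linarith [mul_le_mul_of_nonneg_left htrans G.γ_nonneg]

lemma abs_actionValue_sub_le (h : ∀ s, |V s - W s| ≤ M) (s : S) (a : A) :
    |G.actionValue y V s a - G.actionValue y W s a| ≤ G.γ * M := by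
  simp only [abs_sub_le_iff] at h ⊢
  simp only [sub_le_iff_le_add'] at h ⊢
  exact ⟨G.actionValue_le_add y (fun s => (h s).1) s a,
    G.actionValue_le_add y (fun s => (h s).2) s a⟩

lemma abs_actionValue_le (h : ∀ s, |V s| ≤ M) (s : S) (a : A) :
    |G.actionValue y V s a| ≤ 1 + G.γ * M := by
  rw [actionValue_apply]
  refine abs_dotProduct_le_of_mem_simplex (y s).2 fun b => (abs_add_le _ _).trans ?_
  obtain ⟨hloss_nonneg, hloss_le⟩ := G.loss_mem s a b
  rw [abs_of_nonneg hloss_nonneg, abs_mul, abs_of_nonneg G.γ_nonneg]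
  gcongr
  · exact G.γ_nonneg
  · exact abs_dotProduct_le_of_mem_simplex (G.trans s a b).2 h

end ActionValue

section OptimalBellman

variable [Fintype B] (G : MarkovGame S A B) (y : Policy S B)

/-- The Bellman optimality operator of Player 1's decision problem against the fixed policy `y`. -/
def optimalBellman (V : S → ℝ) (s : S) : ℝ := ⨅ a, G.actionValue y V s a

variable [Finite A]

lemma optimalBellman_le_actionValue (V : S → ℝ) (s : S) (a : A) :
    G.optimalBellman y V s ≤ G.actionValue y V s a :=
  ciInf_le (Set.finite_range _).bddBelow a

variable [Nonempty A]

lemma exists_actionValue_eq_optimalBellman (V : S → ℝ) (s : S) :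
    ∃ a, G.actionValue y V s a = G.optimalBellman y V s :=
  exists_eq_ciInf_of_finite

lemma optimalBellman_sub_le (V W : S → ℝ) (s : S) :
    G.optimalBellman y V s - G.optimalBellman y W s ≤ G.γ * dist V W := by
  obtain ⟨a, ha⟩ := G.exists_actionValue_eq_optimalBellman y W s
  have hdist (s : S) : V s ≤ W s + dist V W := by
    linarith [le_abs_self (V s - W s), dist_le_pi_dist V W s, Real.dist_eq (V s) (W s)]
  linarith [G.optimalBellman_le_actionValue y V s a, G.actionValue_le_add y hdist s a]

lemma contractingWith_optimalBellman :
    ContractingWith ⟨G.γ, G.γ_nonneg⟩ (G.optimalBellman y) := by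
  refine ⟨NNReal.coe_lt_coe.1 G.γ_lt_one, LipschitzWith.of_dist_le_mul fun V W => ?_⟩
  refine (dist_pi_le_iff (mul_nonneg G.γ_nonneg dist_nonneg)).2 fun s => ?_
  rw [Real.dist_eq, abs_sub_le_iff]
  exact ⟨G.optimalBellman_sub_le y V W s, dist_comm W V ▸ G.optimalBellman_sub_le y W V s⟩

end OptimalBellman

variable [Fintype A] [Fintype B] (G : MarkovGame S A B) (y : Policy S B)
  {V : S → ℝ} {x : Policy S A}

lemma value_eq_dotProduct_actionValue (x : Policy S A) (s : S) :
    G.value x y s = (x s).1.ofLp ⬝ᵥ G.actionValue y (G.value x y) s :=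
  G.value_eq_dotProduct_qMatrix x y s

lemma value_sub_le {g : ℝ} (h : ∀ s, (x s).1.ofLp ⬝ᵥ G.actionValue y V s ≤ V s + g) (s : S) :
    G.value x y s - V s ≤ g / (1 - G.γ) := by
  refine le_div_one_sub_of_forall_bound (D := fun s => G.value x y s - V s) G.γ_lt_one
    (fun M hM s => ?_) s
  have hdot := dotProduct_le_dotProduct_add_of_mem_simplex (x s).2
    (G.actionValue_le_add y (fun s => sub_le_iff_le_add'.1 (hM s)) s)
  rw [value_eq_dotProduct_actionValue]
  linarith [h s]

lemma value_le_of_dotProduct_le (h : ∀ s, (x s).1.ofLp ⬝ᵥ G.actionValue y V s ≤ V s) (s : S) :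
    G.value x y s ≤ V s := by
  simpa using G.value_sub_le y (g := 0) (fun s => by simpa using h s) s

lemma le_value_of_le_dotProduct (h : ∀ s, V s ≤ (x s).1.ofLp ⬝ᵥ G.actionValue y V s) (s : S) :
    V s ≤ G.value x y s := by
  have hdiff : V s - G.value x y s ≤ 0 / (1 - G.γ) := by
    refine le_div_one_sub_of_forall_bound (D := fun s => V s - G.value x y s) G.γ_lt_one
      (fun M hM s => ?_) s
    have hdot := dotProduct_le_dotProduct_add_of_mem_simplex (x s).2
      (G.actionValue_le_add y (fun s => sub_le_iff_le_add'.1 (hM s)) s)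
    rw [value_eq_dotProduct_actionValue]
    linarith [h s]
  simpa using hdiff

section OptimalPolicy

variable [Nonempty A]

lemma exists_value_eq_of_isFixedPt (hV : Function.IsFixedPt (G.optimalBellman y) V) :
    ∃ x : Policy S A, G.value x y = V := by
  classical
  choose a ha using G.exists_actionValue_eq_optimalBellman y V
  let greedy : Policy S A := fun s => ⟨EuclideanSpace.single (a s) 1, single_mem_simplex (a s)⟩
  have hgreedy (s : S) : (greedy s).1.ofLp ⬝ᵥ G.actionValue y V s = V s := by
    rw [single_dotProduct_eq_apply, ha, hV.eq]
  exact ⟨greedy, funext fun s => le_antisymm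
    (G.value_le_of_dotProduct_le y (fun s => (hgreedy s).le) s)
    (G.le_value_of_le_dotProduct y (fun s => (hgreedy s).ge) s)⟩

lemma bestValue_eq_of_isFixedPt (hV : Function.IsFixedPt (G.optimalBellman y) V) :
    G.bestValue y = V := by
  obtain ⟨x, hx⟩ := G.exists_value_eq_of_isFixedPt y hV
  have hlower (x' : Policy S A) (s : S) : V s ≤ G.value x' y s :=
    G.le_value_of_le_dotProduct y (fun s => le_dotProduct_of_mem_simplex (x' s).2 fun a =>
      (congrFun hV.eq s).ge.trans (G.optimalBellman_le_actionValue y V s a)) s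
  have : Nonempty (Policy S A) := ⟨x⟩
  refine funext fun s => le_antisymm ?_ (le_ciInf fun x' => hlower x' s)
  rw [← hx]
  exact ciInf_le ⟨0, Set.forall_mem_range.2 fun x' => G.value_nonneg x' y s⟩ x

lemma isFixedPt_optimalBellman_bestValue :
    Function.IsFixedPt (G.optimalBellman y) (G.bestValue y) := by
  have hfix := (G.contractingWith_optimalBellman y).fixedPoint_isFixedPt
  rwa [← G.bestValue_eq_of_isFixedPt y hfix] at hfix

lemma exists_value_eq_bestValue : ∃ x : Policy S A, G.value x y = G.bestValue y :=
  G.exists_value_eq_of_isFixedPt y (G.isFixedPt_optimalBellman_bestValue y)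

lemma exists_actionValue_eq_bestValue (s : S) :
    ∃ a, G.actionValue y (G.bestValue y) s a = G.bestValue y s := by
  simpa only [(G.isFixedPt_optimalBellman_bestValue y).eq]
    using G.exists_actionValue_eq_optimalBellman y (G.bestValue y) s

end OptimalPolicy

lemma bestValue_le_actionValue (s : S) (a : A) :
    G.bestValue y s ≤ G.actionValue y (G.bestValue y) s a := by
  have : Nonempty A := ⟨a⟩
  exact (congrFun (G.isFixedPt_optimalBellman_bestValue y).eq s).ge.trans
    (G.optimalBellman_le_actionValue y _ s a)

lemma bestValue_le_dotProduct {v : EuclideanSpace ℝ A} (hv : v ∈ simplex A) (s : S) :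
    G.bestValue y s ≤ v.ofLp ⬝ᵥ G.actionValue y (G.bestValue y) s :=
  le_dotProduct_of_mem_simplex hv (G.bestValue_le_actionValue y s)

lemma bestValue_nonneg (s : S) : 0 ≤ G.bestValue y s :=
  Real.iInf_nonneg fun x => G.value_nonneg x y s

lemma bestValue_le_value (x : Policy S A) (s : S) : G.bestValue y s ≤ G.value x y s :=
  ciInf_le ⟨0, Set.forall_mem_range.2 fun x' => G.value_nonneg x' y s⟩ x

lemma bestValue_le (s : S) : G.bestValue y s ≤ 1 / (1 - G.γ) := by
  rcases isEmpty_or_nonempty (Policy S A) with _ | ⟨⟨x⟩⟩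
  · rw [bestValue, Real.iInf_of_isEmpty]
    exact (one_div_pos.2 G.one_sub_γ_pos).le
  · exact (G.bestValue_le_value y x s).trans (G.value_le x y s)

lemma mem_bestResponses_iff : x ∈ G.bestResponses y ↔
    ∀ s, (x s).1.ofLp ⬝ᵥ G.actionValue y (G.bestValue y) s = G.bestValue y s := by
  constructor
  · intro hx s
    have : Nonempty A := nonempty_of_mem_simplex (x s).2
    obtain ⟨x₀, hx₀⟩ := G.exists_value_eq_bestValue y
    have hvalue : G.value x y = G.bestValue y := funext fun s =>
      le_antisymm ((hx s x₀).trans_eq (congrFun hx₀ s)) (G.bestValue_le_value y x s)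
    rw [← hvalue, ← value_eq_dotProduct_actionValue]
  · intro hx s x'
    exact (G.value_le_of_dotProduct_le y (fun s => (hx s).le) s).trans
      (G.bestValue_le_value y x' s)

lemma bestResponses_nonempty [Nonempty A] : (G.bestResponses y).Nonempty := by
  obtain ⟨x, hx⟩ := G.exists_value_eq_bestValue y
  exact ⟨x, fun s x' => (congrFun hx s).trans_le (G.bestValue_le_value y x' s)⟩

lemma bestResponsesAt_nonempty [Nonempty A] (s : S) : (G.bestResponsesAt y s).Nonempty := by
  obtain ⟨x, hx⟩ := G.bestResponses_nonempty y
  exact ⟨(x s).1, x, hx, rfl⟩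

lemma mem_bestResponsesAt_iff {s : S} {v : EuclideanSpace ℝ A} : v ∈ G.bestResponsesAt y s ↔
    v ∈ simplex A ∧ v.ofLp ⬝ᵥ G.actionValue y (G.bestValue y) s = G.bestValue y s := by
  classical
  constructor
  · rintro ⟨x, hx, rfl⟩
    exact ⟨(x s).2, (G.mem_bestResponses_iff y).1 hx s⟩
  · rintro ⟨hv, hopt⟩
    have : Nonempty A := nonempty_of_mem_simplex hv
    obtain ⟨x, hx⟩ := G.bestResponses_nonempty y
    refine ⟨Function.update x s ⟨v, hv⟩, (G.mem_bestResponses_iff y).2 fun s' => ?_, by simp⟩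
    rcases eq_or_ne s' s with rfl | hs
    · simpa using hopt
    · rw [Function.update_of_ne hs]
      exact (G.mem_bestResponses_iff y).1 hx s'

lemma convex_bestResponsesAt (s : S) : Convex ℝ (G.bestResponsesAt y s) := by
  intro v hv w hw a b ha hb hab
  rw [mem_bestResponsesAt_iff] at hv hw ⊢
  refine ⟨convex_simplex hv.1 hw.1 ha hb hab, ?_⟩
  simp only [WithLp.ofLp_add, WithLp.ofLp_smul, add_dotProduct, smul_dotProduct, hv.2, hw.2,
    smul_eq_mul]
  rw [← add_mul, hab, one_mul]

lemma isCompact_bestResponsesAt (s : S) : IsCompact (G.bestResponsesAt y s) := by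
  have hinter : G.bestResponsesAt y s = simplex A ∩
      {v | v.ofLp ⬝ᵥ G.actionValue y (G.bestValue y) s = G.bestValue y s} :=
    Set.ext fun _ => G.mem_bestResponsesAt_iff y
  rw [hinter]
  exact isCompact_simplex.inter_right
    (isClosed_eq (continuous_ofLp_dotProduct _) continuous_const)

end MarkovGame

/-! ### One-step suboptimality and error bounds -/

namespace MarkovGame

variable [Fintype S] [Fintype A] [Fintype B]
  (G : MarkovGame S A B) (y : Policy S B) {s : S} {a : A} {v w : EuclideanSpace ℝ A} {C : ℝ}

/-- The one-step suboptimality of `v` at `s` against `y`, measured with the best-response values: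
the left-hand side `max_{v'} (v - v')ᵀ Q_⋆^s y^s` of the error bound (`iSup_sub_dotProduct`). -/
def gap (s : S) (v : EuclideanSpace ℝ A) : ℝ :=
  v.ofLp ⬝ᵥ G.actionValue y (G.bestValue y) s - G.bestValue y s

lemma gap_nonneg (hv : v ∈ simplex A) (s : S) : 0 ≤ G.gap y s v :=
  sub_nonneg.2 (G.bestValue_le_dotProduct y hv s)

lemma gap_le (hv : v ∈ simplex A) (s : S) : G.gap y s v ≤ 1 / (1 - G.γ) := by
  have hbest (s : S) : |G.bestValue y s| ≤ 1 / (1 - G.γ) := by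
    rw [abs_of_nonneg (G.bestValue_nonneg y s)]
    exact G.bestValue_le y s
  have hdot := abs_dotProduct_le_of_mem_simplex hv (G.abs_actionValue_le y hbest s)
  have hfix : 1 + G.γ * (1 / (1 - G.γ)) = 1 / (1 - G.γ) := by
    field [G.one_sub_γ_pos.ne']
  unfold gap
  linarith [(abs_le.1 hdot).2, G.bestValue_nonneg y s]

lemma gap_eq_sum (hv : v ∈ simplex A) (s : S) :
    G.gap y s v = ∑ a, v.ofLp a * (G.actionValue y (G.bestValue y) s a - G.bestValue y s) := by
  simp only [gap, dotProduct, mul_sub, Finset.sum_sub_distrib, ← Finset.sum_mul, hv.2, one_mul]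

lemma mem_bestResponsesAt_iff_gap_eq_zero :
    v ∈ G.bestResponsesAt y s ↔ v ∈ simplex A ∧ G.gap y s v = 0 := by
  rw [mem_bestResponsesAt_iff, gap, sub_eq_zero]

lemma value_sub_bestValue_le_sum_gap (x : Policy S A) (s : S) :
    G.value x y s - G.bestValue y s ≤ (∑ s', G.gap y s' (x s').1) / (1 - G.γ) := by
  refine G.value_sub_le y (fun s' => ?_) s
  rw [← sub_le_iff_le_add']
  exact Finset.single_le_sum (f := fun s' => G.gap y s' (x s').1)
    (fun s' _ => G.gap_nonneg y (x s').2 s') (Finset.mem_univ s')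

/-- The worst-case suboptimality of `x` against `y`, over all start states and all competing
policies. -/
def suboptimality (x : Policy S A) : ℝ :=
  ⨆ q : S × Policy S A, (G.value x y q.1 - G.value q.2 y q.1)

lemma suboptimality_le {x : Policy S A} {M : ℝ} (hM : 0 ≤ M)
    (h : ∀ s, G.value x y s - G.bestValue y s ≤ M) : G.suboptimality y x ≤ M :=
  Real.iSup_le (fun q => by linarith [h q.1, G.bestValue_le_value y q.2 q.1]) hM

lemma suboptimality_le_one_div (x : Policy S A) : G.suboptimality y x ≤ 1 / (1 - G.γ) :=
  G.suboptimality_le y (one_div_pos.2 G.one_sub_γ_pos).le fun s => by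
    linarith [G.value_le x y s, G.bestValue_nonneg y s]

lemma suboptimality_le_sum_gap (x : Policy S A) :
    G.suboptimality y x ≤ (∑ s, G.gap y s (x s).1) / (1 - G.γ) :=
  G.suboptimality_le y
    (div_nonneg (Finset.sum_nonneg fun s _ => G.gap_nonneg y (x s).2 s) G.one_sub_γ_pos.le)
    (G.value_sub_bestValue_le_sum_gap y x)

lemma iSup_sub_dotProduct (s : S) (v : simplex A) :
    (⨆ v' : simplex A,
        (v.1.ofLp ⬝ᵥ (G.qMatrix (G.bestValue y) s *ᵥ (y s).1.ofLp) -
          v'.1.ofLp ⬝ᵥ (G.qMatrix (G.bestValue y) s *ᵥ (y s).1.ofLp))) = G.gap y s v.1 := by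
  have : Nonempty (simplex A) := ⟨v⟩
  have : Nonempty A := nonempty_of_mem_simplex v.2
  obtain ⟨w, hw⟩ := G.bestResponsesAt_nonempty y s
  rw [mem_bestResponsesAt_iff] at hw
  have hle (v' : simplex A) : v.1.ofLp ⬝ᵥ (G.qMatrix (G.bestValue y) s *ᵥ (y s).1.ofLp) -
      v'.1.ofLp ⬝ᵥ (G.qMatrix (G.bestValue y) s *ᵥ (y s).1.ofLp) ≤ G.gap y s v.1 :=
    sub_le_sub_left (G.bestValue_le_dotProduct y v'.2 s) _
  refine le_antisymm (ciSup_le hle)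
    (le_ciSup_of_le ⟨_, Set.forall_mem_range.2 hle⟩ ⟨w, hw.1⟩ ?_)
  exact sub_le_sub_left hw.2.le _

lemma isErrorBoundConst_iff : G.IsErrorBoundConst y C ↔
    ∀ s, ∀ v ∈ simplex A, C * Metric.infDist v (G.bestResponsesAt y s) ≤ G.gap y s v := by
  unfold IsErrorBoundConst
  simp_rw [iSup_sub_dotProduct]
  exact ⟨fun h s v hv => h s ⟨v, hv⟩, fun h s v => h s v.1 v.2⟩

lemma exists_pos_le_actionValue_sub : ∃ c : ℝ, 0 < c ∧ ∀ (s : S) (a : A),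
    G.actionValue y (G.bestValue y) s a ≠ G.bestValue y s →
      c ≤ G.actionValue y (G.bestValue y) s a - G.bestValue y s := by
  have hsmall : ∀ᶠ c : ℝ in nhdsWithin 0 (Set.Ioi 0), ∀ p : S × A,
      G.actionValue y (G.bestValue y) p.1 p.2 ≠ G.bestValue y p.1 →
        c ≤ G.actionValue y (G.bestValue y) p.1 p.2 - G.bestValue y p.1 := by
    simp only [Filter.eventually_all]
    intro p hp
    exact nhdsWithin_le_nhds <| Iic_mem_nhds <|
      sub_pos.2 ((G.bestValue_le_actionValue y p.1 p.2).lt_of_ne' hp)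
  obtain ⟨c, hle, hc⟩ := (hsmall.and self_mem_nhdsWithin).exists
  exact ⟨c, hc, fun s a => hle (s, a)⟩

lemma single_mem_bestResponsesAt_iff [DecidableEq A] :
    EuclideanSpace.single a 1 ∈ G.bestResponsesAt y s ↔
      G.actionValue y (G.bestValue y) s a = G.bestValue y s := by
  rw [mem_bestResponsesAt_iff, single_dotProduct_eq_apply, and_iff_right (single_mem_simplex a)]

/- The point `w` arises from `v` by moving the mass of each suboptimal action to an optimal one. -/
lemma exists_mem_bestResponsesAt_mul_norm_sub_le {c : ℝ} (hc : 0 ≤ c)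
    (hgap : ∀ a, G.actionValue y (G.bestValue y) s a ≠ G.bestValue y s →
      c ≤ G.actionValue y (G.bestValue y) s a - G.bestValue y s) (hv : v ∈ simplex A) :
    ∃ w ∈ G.bestResponsesAt y s, c / 2 * ‖v - w‖ ≤ G.gap y s v := by
  classical
  have : Nonempty A := nonempty_of_mem_simplex hv
  obtain ⟨a₀, ha₀⟩ := G.exists_actionValue_eq_bestValue y s
  let f : A → A := fun a => if G.actionValue y (G.bestValue y) s a = G.bestValue y s then a else a₀
  have hf (a : A) : EuclideanSpace.single (f a) 1 ∈ G.bestResponsesAt y s := by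
    rw [single_mem_bestResponsesAt_iff]
    by_cases ha : G.actionValue y (G.bestValue y) s a = G.bestValue y s <;> simp [f, ha, ha₀]
  have hmove (a : A) : c / 2 * ‖EuclideanSpace.single a (1 : ℝ) - EuclideanSpace.single (f a) 1‖ ≤
      G.actionValue y (G.bestValue y) s a - G.bestValue y s := by
    by_cases ha : G.actionValue y (G.bestValue y) s a = G.bestValue y s
    · simp [f, ha]
    · have hnorm := norm_sub_le_two (single_mem_simplex a) (single_mem_simplex (f a))
      linarith [hgap a ha, mul_le_mul_of_nonneg_left hnorm (div_nonneg hc zero_le_two)]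
  refine ⟨∑ a, v.ofLp a • EuclideanSpace.single (f a) 1,
    (G.convex_bestResponsesAt y s).sum_mem (fun a _ => hv.1 a) hv.2 fun a _ => hf a, ?_⟩
  calc c / 2 * ‖v - ∑ a, v.ofLp a • EuclideanSpace.single (f a) (1 : ℝ)‖
      = c / 2 * ‖∑ a, v.ofLp a •
          (EuclideanSpace.single a (1 : ℝ) - EuclideanSpace.single (f a) 1)‖ := by
        simp_rw [smul_sub, Finset.sum_sub_distrib, sum_smul_single_one]
    _ ≤ c / 2 * ∑ a, v.ofLp a *
          ‖EuclideanSpace.single a (1 : ℝ) - EuclideanSpace.single (f a) 1‖ := by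
        gcongr
        refine (norm_sum_le _ _).trans_eq (Finset.sum_congr rfl fun a _ => ?_)
        rw [norm_smul, Real.norm_of_nonneg (hv.1 a)]
    _ ≤ G.gap y s v := by
        rw [gap_eq_sum G y hv, Finset.mul_sum]
        refine Finset.sum_le_sum fun a _ => ?_
        rw [mul_left_comm]
        exact mul_le_mul_of_nonneg_left (hmove a) (hv.1 a)

theorem exists_isErrorBoundConst : ∃ C : ℝ, 0 < C ∧ G.IsErrorBoundConst y C := by
  obtain ⟨c, hc, hgap⟩ := G.exists_pos_le_actionValue_sub y
  refine ⟨c / 2, half_pos hc, (G.isErrorBoundConst_iff y).2 fun s v hv => ?_⟩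
  obtain ⟨w, hw, hle⟩ := G.exists_mem_bestResponsesAt_mul_norm_sub_le y hc.le (hgap s) hv
  have hdist := Metric.infDist_le_dist_of_mem (x := v) hw
  rw [dist_eq_norm] at hdist
  exact (mul_le_mul_of_nonneg_left hdist (half_pos hc).le).trans hle

lemma apply_eq_zero_of_mem_bestResponsesAt (hw : w ∈ G.bestResponsesAt y s)
    (ha : G.actionValue y (G.bestValue y) s a ≠ G.bestValue y s) : w.ofLp a = 0 := by
  obtain ⟨hws, hgap⟩ := (G.mem_bestResponsesAt_iff_gap_eq_zero y).1 hw
  rw [gap_eq_sum G y hws, Finset.sum_eq_zero_iff_of_nonneg fun b _ =>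
    mul_nonneg (hws.1 b) (sub_nonneg.2 (G.bestValue_le_actionValue y s b))] at hgap
  exact (mul_eq_zero.1 (hgap a (Finset.mem_univ a))).resolve_right (sub_ne_zero.2 ha)

lemma one_le_infDist_single [DecidableEq A]
    (ha : G.actionValue y (G.bestValue y) s a ≠ G.bestValue y s) :
    1 ≤ Metric.infDist (EuclideanSpace.single a 1) (G.bestResponsesAt y s) := by
  have : Nonempty A := ⟨a⟩
  refine (Metric.le_infDist (G.bestResponsesAt_nonempty y s)).2 fun w hw => ?_
  rw [dist_eq_norm]
  refine le_trans ?_ (PiLp.norm_apply_le _ a)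
  simp [G.apply_eq_zero_of_mem_bestResponsesAt y hw ha]

theorem bestResponsesAt_eq_simplex_or_le (hC : G.IsErrorBoundConst y C) (hC₀ : 0 ≤ C) :
    (∀ s, G.bestResponsesAt y s = simplex A) ∨ C ≤ 1 / (1 - G.γ) := by
  classical
  by_cases h : ∃ s a, G.actionValue y (G.bestValue y) s a ≠ G.bestValue y s
  · obtain ⟨s, a, ha⟩ := h
    have hbound := (G.isErrorBoundConst_iff y).1 hC s _ (single_mem_simplex a)
    exact .inr <| (le_mul_of_one_le_right hC₀ (G.one_le_infDist_single y ha)).trans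
      (hbound.trans (G.gap_le y (single_mem_simplex a) s))
  · push Not at h
    refine .inl fun s => Set.ext fun v => ?_
    rw [mem_bestResponsesAt_iff, and_iff_left_iff_imp]
    intro hv
    rw [funext (h s), dotProduct_const_of_mem_simplex hv]

end MarkovGame

/-! ### The learning rate of the critic -/

namespace MarkovGame

variable [Fintype S] (G : MarkovGame S A B)

lemma rate_eq (t : ℕ) : G.rate t = (2 + (1 - G.γ)) / (2 + (1 - G.γ) * t) := by
  have := G.one_sub_γ_pos
  unfold rate
  field

lemma rate_pos (t : ℕ) : 0 < G.rate t := by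
  have := G.one_sub_γ_pos
  unfold rate
  positivity

lemma rate_le_one {t : ℕ} (ht : 1 ≤ t) : G.rate t ≤ 1 := by
  have hd := G.one_sub_γ_pos
  have ht' : (1 : ℝ) ≤ t := mod_cast ht
  unfold rate
  rw [div_le_one (by positivity)]
  gcongr

lemma one_le_rate_zero : 1 ≤ G.rate 0 := by
  have hd := G.one_sub_γ_pos
  unfold rate
  rw [Nat.cast_zero, one_le_div (by positivity)]
  gcongr
  exact zero_le_one

lemma rate_sub_rate_succ (t : ℕ) : G.rate t - G.rate (t + 1) =
    (1 - G.γ) / (2 + (1 - G.γ)) * (G.rate t * G.rate (t + 1)) := by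
  have := G.one_sub_γ_pos
  simp only [rate_eq, Nat.cast_succ]
  field

lemma rate_succ_le (t : ℕ) : G.rate (t + 1) ≤ G.rate t := by
  have := G.one_sub_γ_pos
  have hnonneg : 0 ≤ (1 - G.γ) / (2 + (1 - G.γ)) * (G.rate t * G.rate (t + 1)) :=
    mul_nonneg (by positivity) (mul_pos (G.rate_pos t) (G.rate_pos _)).le
  linarith [G.rate_sub_rate_succ t]

lemma rate_sub_rate_succ_le (t : ℕ) :
    G.rate t - G.rate (t + 1) ≤ (1 - G.γ) / 2 * (G.rate t * G.rate (t + 1)) := by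
  have := G.one_sub_γ_pos
  rw [rate_sub_rate_succ]
  refine mul_le_mul_of_nonneg_right ?_ (mul_pos (G.rate_pos t) (G.rate_pos _)).le
  gcongr
  linarith

lemma rate_le (t : ℕ) : G.rate t ≤ 3 / ((1 - G.γ) * (t + 1)) := by
  have := G.one_sub_γ_pos
  rw [rate_eq, div_le_div_iff₀ (by positivity) (by positivity)]
  nlinarith [G.γ_nonneg, mul_nonneg this.le (Nat.cast_nonneg (α := ℝ) t)]

end MarkovGame

/-! ### Optimistic gradient descent -/

namespace MarkovGame.SinglePlayerRun

variable [Fintype S] [Fintype A] [Fintype B]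
  {G : MarkovGame S A B} {y : Policy S B} {η ε : ℝ} {T t : ℕ} {v w : EuclideanSpace ℝ A}

lemma card_pos (R : G.SinglePlayerRun y η ε T) : 0 < Fintype.card S := by
  refine Nat.pos_of_ne_zero fun hcard => R.η_pos.not_ge ?_
  simpa [hcard] using R.η_le

lemma η_le_sq (R : G.SinglePlayerRun y η ε T) : η ≤ 1 / 10 ^ 4 * (1 - G.γ) ^ 2 := by
  have hd := G.one_sub_γ_pos
  have hcard : (1 : ℝ) ≤ Fintype.card S := mod_cast R.card_pos
  refine R.η_le.trans (mul_le_mul_of_nonneg_left ?_ (by norm_num))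
  refine Real.sqrt_le_iff.2 ⟨by positivity, ?_⟩
  calc (1 - G.γ) ^ 5 / (Fintype.card S : ℝ) ≤ (1 - G.γ) ^ 5 := div_le_self (by positivity) hcard
    _ ≤ ((1 - G.γ) ^ 2) ^ 2 := by
      rw [← pow_mul]
      exact pow_le_pow_of_le_one hd.le (sub_le_self 1 G.γ_nonneg) (by norm_num)

lemma η_le_one_sub_γ (R : G.SinglePlayerRun y η ε T) : η ≤ 1 - G.γ := by
  nlinarith [R.η_le_sq, G.one_sub_γ_pos, G.γ_nonneg]

lemma η_le_one (R : G.SinglePlayerRun y η ε T) : η ≤ 1 :=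
  R.η_le_one_sub_γ.trans (sub_le_self 1 G.γ_nonneg)

variable (R : G.SinglePlayerRun y η ε T)

lemma V_succ (ht : t + 1 ≤ T) (s : S) :
    R.V (t + 1) s = (1 - G.rate (t + 1)) * R.V t s + G.rate (t + 1) * R.ρ (t + 1) s :=
  R.V_update (t + 1) (Finset.mem_Icc.2 ⟨t.succ_pos, ht⟩) s

lemma abs_ρ_sub_le (ht : t + 1 ≤ T) (s : S) :
    |R.ρ (t + 1) s - (R.x (t + 1) s).1.ofLp ⬝ᵥ G.actionValue y (R.V t) s| ≤ ε :=
  R.ρ_approx (t + 1) (Finset.mem_Icc.2 ⟨t.succ_pos, ht⟩) s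

lemma abs_inner_sub_le (ht : t + 1 ≤ T) (s : S) (hv : v ∈ simplex A) (hw : w ∈ simplex A) :
    |inner ℝ (v - w) (R.l (t + 1) s) -
      (v.ofLp ⬝ᵥ G.actionValue y (R.V t) s - w.ofLp ⬝ᵥ G.actionValue y (R.V t) s)| ≤ 2 * ε := by
  rw [← inner_toLp, ← inner_toLp, ← inner_sub_left, ← inner_sub_right]
  exact (abs_real_inner_le_norm _ _).trans <| mul_le_mul (norm_sub_le_two hv hw)
    (R.l_approx (t + 1) (Finset.mem_Icc.2 ⟨t.succ_pos, ht⟩) s) (norm_nonneg _) zero_le_two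

lemma abs_ρ_le (ht : t + 1 ≤ T) (hV : ∀ s, |R.V t s| ≤ (1 + ε) / (1 - G.γ)) (s : S) :
    |R.ρ (t + 1) s| ≤ (1 + ε) / (1 - G.γ) := by
  have hdot := abs_dotProduct_le_of_mem_simplex (R.x (t + 1) s).2 (G.abs_actionValue_le y hV s)
  have hfix : 1 + G.γ * ((1 + ε) / (1 - G.γ)) + ε = (1 + ε) / (1 - G.γ) := by
    field [G.one_sub_γ_pos.ne']
  calc |R.ρ (t + 1) s|
      = |(R.x (t + 1) s).1.ofLp ⬝ᵥ G.actionValue y (R.V t) s +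
          (R.ρ (t + 1) s - (R.x (t + 1) s).1.ofLp ⬝ᵥ G.actionValue y (R.V t) s)| := by
        rw [add_sub_cancel]
    _ ≤ 1 + G.γ * ((1 + ε) / (1 - G.γ)) + ε :=
        (abs_add_le _ _).trans (add_le_add hdot (R.abs_ρ_sub_le ht s))
    _ = (1 + ε) / (1 - G.γ) := hfix

lemma abs_V_le (ht : t ≤ T) (s : S) : |R.V t s| ≤ (1 + ε) / (1 - G.γ) := by
  induction t generalizing s with
  | zero =>
    rw [R.V_init, abs_zero]
    exact div_nonneg (add_nonneg zero_le_one R.ε_nonneg) G.one_sub_γ_pos.le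
  | succ t ih =>
    have hV (s : S) := ih (by omega) s
    rw [R.V_succ ht, abs_le]
    exact convex_Icc _ _ (abs_le.1 (hV s)) (abs_le.1 (R.abs_ρ_le ht hV s))
      (sub_nonneg.2 (G.rate_le_one t.succ_pos)) (G.rate_pos _).le (sub_add_cancel _ _)

lemma abs_V_succ_sub_le (ht : t + 1 ≤ T) (s : S) :
    |R.V (t + 1) s - R.V t s| ≤ G.rate (t + 1) / (2 * η) := by
  have hd := G.one_sub_γ_pos
  have hη := R.η_pos
  have hV (s : S) := R.abs_V_le (t := t) (by omega) s
  have hstep : R.V (t + 1) s - R.V t s = G.rate (t + 1) * (R.ρ (t + 1) s - R.V t s) := by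
    rw [R.V_succ ht]
    ring
  have hbound : (1 + ε) / (1 - G.γ) + (1 + ε) / (1 - G.γ) ≤ 1 / (2 * η) := by
    have hεd : ε * (1 - G.γ) ≤ 1 := (le_div_iff₀ hd).1 R.ε_le
    rw [← add_div, div_le_div_iff₀ hd (by positivity)]
    nlinarith [mul_le_mul_of_nonneg_right R.η_le_sq R.ε_nonneg,
      mul_le_mul_of_nonneg_right hεd hd.le, R.η_le_sq, G.γ_nonneg]
  rw [hstep, abs_mul, abs_of_pos (G.rate_pos _), ← mul_one_div]
  refine mul_le_mul_of_nonneg_left ((abs_sub _ _).trans ?_) (G.rate_pos _).le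
  linarith [R.abs_ρ_le ht hV s, hV s]

/- The prediction is the previous loss estimate, or `0` in the first round, where `x_1 = x̂_1`. -/
lemma exists_prediction (ht : t + 1 ≤ T) (s : S) : ∃ m : EuclideanSpace ℝ A,
    IsProj (simplex A) ((R.xhat (t + 1) s).1 - η • m) (R.x (t + 1) s).1 ∧
      ∀ v ∈ simplex A, ∀ w ∈ simplex A,
        inner ℝ (v - w) (R.l (t + 1) s - m) ≤ 4 * ε + G.rate t / η := by
  have hη := R.η_pos
  have hε := R.ε_nonneg
  rcases t with _ | t
  · refine ⟨0, ?_, fun v hv w hw => ?_⟩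
    · rw [smul_zero, sub_zero, zero_add, R.x_init]
      exact ⟨(R.x 1 s).2, fun w _ => by simp⟩
    · have hloss := dotProduct_sub_le_of_mem_simplex hv hw (g := 0) (c := 1) fun a => by
        simpa using G.abs_actionValue_le y (V := R.V 0) (M := 0) (fun s => by simp [R.V_init]) s a
      have hinner := (abs_le.1 (R.abs_inner_sub_le ht s hv hw)).2
      have hrate : 2 ≤ G.rate 0 / η := by
        rw [le_div_iff₀ hη]
        linarith [R.η_le_one_sub_γ, G.γ_mem.1, G.one_le_rate_zero]
      simp only [dotProduct_zero] at hloss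
      rw [sub_zero]
      linarith
  · refine ⟨R.l (t + 1) s, R.x_update (t + 1) (Finset.mem_Icc.2 ⟨t.succ_pos, by omega⟩) s,
      fun v hv w hw => ?_⟩
    have hdrift := dotProduct_sub_le_of_mem_simplex hv hw
      (G.abs_actionValue_sub_le y (fun s => R.abs_V_succ_sub_le (t := t) (by omega) s) s)
    have hnew := (abs_le.1 (R.abs_inner_sub_le ht s hv hw)).2
    have hold := (abs_le.1 (R.abs_inner_sub_le (t := t) (by omega) s hv hw)).1
    have hhalf : G.rate (t + 1) / η = 2 * (G.rate (t + 1) / (2 * η)) := by field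
    have hγ : G.γ * (G.rate (t + 1) / (2 * η)) ≤ G.rate (t + 1) / (2 * η) :=
      mul_le_of_le_one_left (div_pos (G.rate_pos _) (by positivity)).le G.γ_lt_one.le
    rw [inner_sub_right]
    linarith

theorem optimistic_regret_le (ht : t + 1 ≤ T) (s : S) (hw : w ∈ simplex A) :
    (R.x (t + 1) s).1.ofLp ⬝ᵥ G.actionValue y (R.V t) s - w.ofLp ⬝ᵥ G.actionValue y (R.V t) s ≤
      (‖(R.xhat (t + 1) s).1 - w‖ ^ 2 - ‖(R.xhat (t + 2) s).1 - w‖ ^ 2) / (2 * η) +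
        6 * ε + G.rate t / η := by
  have hη := R.η_pos
  obtain ⟨m, hx, hm⟩ := R.exists_prediction ht s
  have hu := R.xhat_update (t + 1) (Finset.mem_Icc.2 ⟨t.succ_pos, ht⟩) s
  have hdescent := hu.two_mul_inner_le_of_prediction convex_simplex hx hw
  have herror := hm _ (R.x (t + 1) s).2 _ (R.xhat (t + 2) s).2
  have hestimate := (abs_le.1 (R.abs_inner_sub_le ht s (R.x (t + 1) s).2 hw)).1
  have hinner : inner ℝ ((R.x (t + 1) s).1 - w) (R.l (t + 1) s) ≤
      (‖(R.xhat (t + 1) s).1 - w‖ ^ 2 - ‖(R.xhat (t + 2) s).1 - w‖ ^ 2) / (2 * η) +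
        inner ℝ ((R.x (t + 1) s).1 - (R.xhat (t + 2) s).1) (R.l (t + 1) s - m) := by
    rw [← sub_le_iff_le_add, le_div_iff₀ (by positivity)]
    linarith
  linarith

end MarkovGame.SinglePlayerRun

/-! ### Accuracy of the critic -/

namespace MarkovGame

section CriticBound

variable [Fintype S] (G : MarkovGame S A B) {η ε : ℝ}

/-- An upper bound for the distance of the critic's values `V_t` from the best-response values
(`SinglePlayerRun.abs_V_sub_bestValue_le`). It is a supersolution of the recursion which that
distance satisfies (`criticBound_succ`). -/
def criticBound (η ε : ℝ) (t : ℕ) : ℝ :=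
  4 / (η * (1 - G.γ)) * G.rate t + 7 * ε / (1 - G.γ)

lemma criticBound_succ (hη : 0 < η) (ε : ℝ) (t : ℕ) :
    (1 - G.rate (t + 1) * (1 - G.γ)) * G.criticBound η ε t +
        G.rate (t + 1) * (2 * (G.rate t / η) + 7 * ε) ≤ G.criticBound η ε (t + 1) := by
  have hd := G.one_sub_γ_pos
  have hdecay := mul_le_mul_of_nonneg_left (G.rate_sub_rate_succ_le t)
    (show 0 ≤ 4 / (η * (1 - G.γ)) by positivity)
  have hdiff : (1 - G.rate (t + 1) * (1 - G.γ)) * G.criticBound η ε t +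
      G.rate (t + 1) * (2 * (G.rate t / η) + 7 * ε) - G.criticBound η ε (t + 1) =
      4 / (η * (1 - G.γ)) * (G.rate t - G.rate (t + 1)) -
        4 / (η * (1 - G.γ)) * ((1 - G.γ) / 2 * (G.rate t * G.rate (t + 1))) := by
    unfold criticBound
    field
  linarith

lemma criticBound_le (hη : 0 < η) (ε : ℝ) (t : ℕ) :
    G.criticBound η ε t ≤ 12 / (η * (1 - G.γ) ^ 2 * (t + 1)) + 7 * ε / (1 - G.γ) := by
  have hd := G.one_sub_γ_pos
  have hrate := mul_le_mul_of_nonneg_left (G.rate_le t)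
    (show 0 ≤ 4 / (η * (1 - G.γ)) by positivity)
  have hprod : 4 / (η * (1 - G.γ)) * (3 / ((1 - G.γ) * (t + 1))) =
      12 / (η * (1 - G.γ) ^ 2 * (t + 1)) := by
    field
  unfold criticBound
  linarith

lemma one_div_le_criticBound_zero (hη : 0 < η) (hη₁ : η ≤ 1) (hε : 0 ≤ ε) :
    1 / (1 - G.γ) ≤ G.criticBound η ε 0 := by
  have hd := G.one_sub_γ_pos
  calc 1 / (1 - G.γ) ≤ 4 / (η * (1 - G.γ)) := by
        gcongr
        · norm_num
        · exact mul_le_of_le_one_left hd.le hη₁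
    _ ≤ 4 / (η * (1 - G.γ)) * G.rate 0 :=
        le_mul_of_one_le_right (by positivity) G.one_le_rate_zero
    _ ≤ G.criticBound η ε 0 := le_add_of_nonneg_right (by positivity)

lemma rate_zero_div_le_criticBound_zero (hη : 0 < η) (hε : 0 ≤ ε) :
    G.rate 0 / η ≤ G.criticBound η ε 0 := by
  have hd := G.one_sub_γ_pos
  have hrate := G.rate_pos 0
  calc G.rate 0 / η = 1 / η * G.rate 0 := by ring
    _ ≤ 4 / (η * (1 - G.γ)) * G.rate 0 := by
        gcongr
        · norm_num
        · exact mul_le_of_le_one_right hη.le (sub_le_self 1 G.γ_nonneg)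
    _ ≤ G.criticBound η ε 0 := le_add_of_nonneg_right (by positivity)

end CriticBound

namespace SinglePlayerRun

variable [Fintype S] [Fintype A] [Fintype B] {G : MarkovGame S A B} {y : Policy S B} {η ε : ℝ}
  {T t : ℕ} (R : G.SinglePlayerRun y η ε T) {s : S} {w : EuclideanSpace ℝ A} {M : ℝ}

lemma bestValue_sub_ρ_le (ht : t + 1 ≤ T) (hM : ∀ s, G.bestValue y s ≤ R.V t s + M) (s : S) :
    G.bestValue y s - R.ρ (t + 1) s ≤ G.γ * M + ε := by
  have hdot := dotProduct_le_dotProduct_add_of_mem_simplex (R.x (t + 1) s).2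
    (G.actionValue_le_add y hM s)
  linarith [G.bestValue_le_dotProduct y (R.x (t + 1) s).2 s, (abs_le.1 (R.abs_ρ_sub_le ht s)).1]

lemma ρ_sub_bestValue_le (hw : w ∈ G.bestResponsesAt y s) (ht : t + 1 ≤ T)
    (hM : ∀ s, R.V t s ≤ G.bestValue y s + M) :
    R.ρ (t + 1) s - G.bestValue y s ≤
      (‖(R.xhat (t + 1) s).1 - w‖ ^ 2 - ‖(R.xhat (t + 2) s).1 - w‖ ^ 2) / (2 * η) +
        G.γ * M + 7 * ε + G.rate t / η := by
  obtain ⟨hws, hwq⟩ := (G.mem_bestResponsesAt_iff y).1 hw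
  have hdot := dotProduct_le_dotProduct_add_of_mem_simplex hws (G.actionValue_le_add y hM s)
  linarith [R.optimistic_regret_le ht s hws, (abs_le.1 (R.abs_ρ_sub_le ht s)).2]

lemma bestValue_sub_V_le (ht : t ≤ T) (s : S) :
    G.bestValue y s - R.V t s ≤ G.criticBound η ε t := by
  induction t generalizing s with
  | zero =>
    rw [R.V_init, sub_zero]
    exact (G.bestValue_le y s).trans (G.one_div_le_criticBound_zero R.η_pos R.η_le_one R.ε_nonneg)
  | succ t ih =>
    have hα := G.rate_pos (t + 1)
    have hη := R.η_pos
    have hε := R.ε_nonneg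
    have hV := mul_le_mul_of_nonneg_left (ih (by omega) s)
      (sub_nonneg.2 (G.rate_le_one t.succ_pos))
    have hρ := mul_le_mul_of_nonneg_left
      (R.bestValue_sub_ρ_le ht (fun s => sub_le_iff_le_add'.1 (ih (by omega) s)) s) hα.le
    have hslack : 0 ≤ G.rate (t + 1) * (2 * (G.rate t / η) + 6 * ε) :=
      mul_nonneg hα.le (add_nonneg (mul_nonneg zero_le_two (div_pos (G.rate_pos t) hη).le)
        (by positivity))
    rw [R.V_succ ht]
    linarith [G.criticBound_succ hη ε t]

/- The regret telescopes with weights `α_{t+1}`, so the distance to the best response enters the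
potential with weight `α_t`. -/
lemma V_sub_bestValue_add_le {z : Policy S A} (hz : z ∈ G.bestResponses y) (ht : t ≤ T) (s : S) :
    R.V t s - G.bestValue y s +
      G.rate t * (‖(R.xhat (t + 1) s).1 - (z s).1‖ ^ 2 / (2 * η)) ≤ G.criticBound η ε t := by
  have hη := R.η_pos
  have hdist (t : ℕ) (s : S) : ‖(R.xhat t s).1 - (z s).1‖ ^ 2 / (2 * η) ≤ 1 / η := by
    rw [div_le_div_iff₀ (by positivity) hη]
    nlinarith [norm_sub_sq_le_two (R.xhat t s).2 (z s).2]
  induction t generalizing s with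
  | zero =>
    have hpot := mul_le_mul_of_nonneg_left (hdist (0 + 1) s) (G.rate_pos 0).le
    rw [mul_one_div] at hpot
    rw [R.V_init]
    linarith [G.bestValue_nonneg y s, G.rate_zero_div_le_criticBound_zero hη R.ε_nonneg]
  | succ t ih =>
    have hα := G.rate_pos (t + 1)
    have hα' := G.rate_pos t
    have hM (s : S) : R.V t s ≤ G.bestValue y s + G.criticBound η ε t := by
      have hpot : 0 ≤ G.rate t * (‖(R.xhat (t + 1) s).1 - (z s).1‖ ^ 2 / (2 * η)) := by positivity
      linarith [ih (by omega) s]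
    have hV := mul_le_mul_of_nonneg_left (ih (by omega) s)
      (sub_nonneg.2 (G.rate_le_one t.succ_pos))
    have hρ := mul_le_mul_of_nonneg_left (R.ρ_sub_bestValue_le (s := s) ⟨z, hz, rfl⟩ ht hM) hα.le
    have hweight : (G.rate (t + 1) - (1 - G.rate (t + 1)) * G.rate t) *
        (‖(R.xhat (t + 1) s).1 - (z s).1‖ ^ 2 / (2 * η)) ≤
          G.rate (t + 1) * G.rate t * (1 / η) :=
      mul_le_mul (by linarith [G.rate_succ_le t]) (hdist _ s) (by positivity) (by positivity)
    rw [R.V_succ ht]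
    rw [sub_div] at hρ
    linear_combination hV + hρ + hweight + G.criticBound_succ hη ε t

lemma abs_V_sub_bestValue_le (ht : t ≤ T) (s : S) :
    |R.V t s - G.bestValue y s| ≤ G.criticBound η ε t := by
  have : Nonempty A := nonempty_of_mem_simplex (R.xhat 1 s).2
  obtain ⟨z, hz⟩ := G.bestResponses_nonempty y
  have hη := R.η_pos
  have hα := G.rate_pos t
  have hpot : 0 ≤ G.rate t * (‖(R.xhat (t + 1) s).1 - (z s).1‖ ^ 2 / (2 * η)) := by positivity
  exact abs_sub_le_iff.2
    ⟨by linarith [R.V_sub_bestValue_add_le hz ht s], R.bestValue_sub_V_le ht s⟩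

theorem gap_xhat_succ_le (ht₁ : 1 ≤ t) (ht : t ≤ T) (hw : w ∈ G.bestResponsesAt y s) :
    G.gap y s (R.xhat (t + 1) s).1 ≤
      (‖(R.xhat t s).1 - w‖ ^ 2 - ‖(R.xhat (t + 1) s).1 - w‖ ^ 2) / (2 * η) +
        24 / (η * (1 - G.γ) ^ 2 * t) + 16 * ε / (1 - G.γ) := by
  obtain ⟨t, rfl⟩ := Nat.exists_eq_add_of_le' ht₁
  have hd := G.one_sub_γ_pos
  have hη := R.η_pos
  obtain ⟨hws, hwq⟩ := (G.mem_bestResponsesAt_iff y).1 hw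
  have hV (s : S) : |G.bestValue y s - R.V t s| ≤ G.criticBound η ε t :=
    abs_sub_comm (R.V t s) _ ▸ R.abs_V_sub_bestValue_le (by omega) s
  have hcritic := dotProduct_sub_le_of_mem_simplex (R.xhat (t + 2) s).2 hws
    (G.abs_actionValue_sub_le y hV s)
  have hγ : G.γ * G.criticBound η ε t ≤ G.criticBound η ε t :=
    mul_le_of_le_one_left ((abs_nonneg _).trans (hV s)) G.γ_lt_one.le
  have hestimate := (abs_le.1 (R.abs_inner_sub_le ht s (R.xhat (t + 2) s).2 hws)).1
  have hdescent : inner ℝ ((R.xhat (t + 2) s).1 - w) (R.l (t + 1) s) ≤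
      (‖(R.xhat (t + 1) s).1 - w‖ ^ 2 - ‖(R.xhat (t + 2) s).1 - w‖ ^ 2) / (2 * η) := by
    have hproj := (R.xhat_update (t + 1) (Finset.mem_Icc.2 ⟨ht₁, ht⟩) s).two_mul_inner_le
      convex_simplex hws
    rw [le_div_iff₀ (by positivity)]
    nlinarith [sq_nonneg ‖(R.xhat (t + 2) s).1 - (R.xhat (t + 1) s).1‖]
  have hε : ε ≤ ε / (1 - G.γ) :=
    le_div_self R.ε_nonneg hd (sub_le_self 1 G.γ_nonneg)
  have hbound := G.criticBound_le hη ε t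
  rw [gap]
  push_cast
  have hdouble : 24 / (η * (1 - G.γ) ^ 2 * (t + 1)) = 2 * (12 / (η * (1 - G.γ) ^ 2 * (t + 1))) := by
    ring
  rw [hwq] at hcritic
  rw [hdouble]
  linarith [mul_div_assoc 7 ε (1 - G.γ), mul_div_assoc 16 ε (1 - G.γ)]

end SinglePlayerRun

end MarkovGame

/-! ### Average suboptimality -/

lemma le_add_of_le_sq_add_sq {a b c : ℝ} (ha : a ≤ 1) (hb : 0 ≤ b) (hc : 0 ≤ c)
    (h : a ≤ b ^ 2 + c ^ 2) : a ≤ b + c := by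
  rcases le_total 1 (b + c) with hlarge | hsmall
  · exact ha.trans hlarge
  · nlinarith

/- The hypotheses on `a` amount to `a d ≤ 1` and `a d ≤ b² + c²`, with `b` and `c` being `d` times
the two square-root terms of the conclusion. -/
lemma le_sqrt_add_sqrt_of_le_add {a d η ε L N : ℝ} (hN : 1 ≤ N) (hη : 0 < η) (hη₁ : η ≤ 1)
    (hd : 0 < d) (hd₁ : d ≤ 1) (hL : 0 ≤ L) (hε : 0 ≤ ε) (ha₁ : a ≤ 1 / d)
    (ha : a ≤ N / d * (76 / (η * d ^ 2) * L + 16 * ε / d)) :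
    a ≤ 9 * (N / (η * d ^ 2) * √L + N * √ε / (√η * d ^ 2)) := by
  set b := 9 * N / (η * d) * √L with hb
  set c := 9 * N / (√η * d) * √ε with hc
  have hb_sq : N * (76 / (η * d ^ 2) * L) ≤ b ^ 2 := by
    have hconst : 76 * η ≤ 81 * N := by linarith
    calc N * (76 / (η * d ^ 2) * L) = N * (76 * η) / (η * d) ^ 2 * L := by field
      _ ≤ N * (81 * N) / (η * d) ^ 2 * L := by gcongr
      _ = b ^ 2 := by
        rw [hb, mul_pow _ √L, Real.sq_sqrt hL]
        ring
  have hc_sq : N * (16 * ε / d) ≤ c ^ 2 := by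
    have hconst : 16 * (η * d) ≤ 81 * N := by linarith [mul_le_one₀ hη₁ hd.le hd₁]
    calc N * (16 * ε / d) = N * (16 * (η * d)) / (η * d ^ 2) * ε := by field
      _ ≤ N * (81 * N) / (η * d ^ 2) * ε := by gcongr
      _ = c ^ 2 := by
        rw [hc, mul_pow _ √ε, div_pow, mul_pow √η, Real.sq_sqrt hη.le, Real.sq_sqrt hε]
        ring
  have hsum : a * d ≤ b + c := by
    refine le_add_of_le_sq_add_sq ((le_div_iff₀ hd).1 ha₁) (by positivity) (by positivity) ?_
    calc a * d ≤ N / d * (76 / (η * d ^ 2) * L + 16 * ε / d) * d := by gcongr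
      _ = N * (76 / (η * d ^ 2) * L) + N * (16 * ε / d) := by field
      _ ≤ b ^ 2 + c ^ 2 := add_le_add hb_sq hc_sq
  calc a ≤ (b + c) / d := (le_div_iff₀ hd).2 hsum
    _ = 9 * (N / (η * d ^ 2) * √L + N * √ε / (√η * d ^ 2)) := by
      rw [hb, hc]
      field

lemma one_le_two_mul_log {x : ℝ} (hx : 2 ≤ x) : 1 ≤ 2 * Real.log x := by
  linarith [Real.log_two_gt_d9, Real.log_le_log two_pos hx]

lemma harmonic_le_three_mul_log {n : ℕ} (hn : 1 ≤ n) :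
    (harmonic n : ℝ) ≤ 3 * Real.log (n + 1 : ℕ) := by
  have hmono : Real.log n ≤ Real.log (n + 1 : ℕ) :=
    Real.log_le_log (mod_cast hn) (mod_cast n.le_succ)
  linarith [harmonic_le_one_add_log n,
    one_le_two_mul_log (x := (n + 1 : ℕ)) (mod_cast Nat.succ_le_succ hn)]

namespace MarkovGame.SinglePlayerRun

variable [Fintype S] [Fintype A] [Fintype B]
  {G : MarkovGame S A B} {y : Policy S B} {η ε : ℝ} {T : ℕ} (R : G.SinglePlayerRun y η ε T)

lemma sum_gap_xhat_add_two_le (s : S) {n : ℕ} (hn : n ≤ T) :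
    ∑ t ∈ Finset.range n, G.gap y s (R.xhat (t + 2) s).1 ≤
      1 / η + 24 / (η * (1 - G.γ) ^ 2) * harmonic n + 16 * ε / (1 - G.γ) * n := by
  have : Nonempty A := nonempty_of_mem_simplex (R.xhat 1 s).2
  obtain ⟨w, hw⟩ := G.bestResponsesAt_nonempty y s
  have hη := R.η_pos
  have htelescope : ∑ t ∈ Finset.range n,
      (‖(R.xhat (t + 1) s).1 - w‖ ^ 2 - ‖(R.xhat (t + 2) s).1 - w‖ ^ 2) ≤ 2 := by
    rw [Finset.sum_range_sub' fun t => ‖(R.xhat (t + 1) s).1 - w‖ ^ 2]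
    exact (sub_le_self _ (sq_nonneg _)).trans
      (norm_sub_sq_le_two (R.xhat 1 s).2 ((G.mem_bestResponsesAt_iff y).1 hw).1)
  have hharmonic : ∑ t ∈ Finset.range n, 24 / (η * (1 - G.γ) ^ 2 * (t + 1 : ℕ)) =
      24 / (η * (1 - G.γ) ^ 2) * harmonic n := by
    simp only [harmonic, Rat.cast_sum, Rat.cast_inv, Rat.cast_natCast, Finset.mul_sum,
      div_eq_mul_inv, mul_inv, mul_assoc]
  calc ∑ t ∈ Finset.range n, G.gap y s (R.xhat (t + 2) s).1
      ≤ ∑ t ∈ Finset.range n,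
          ((‖(R.xhat (t + 1) s).1 - w‖ ^ 2 - ‖(R.xhat (t + 2) s).1 - w‖ ^ 2) / (2 * η) +
            24 / (η * (1 - G.γ) ^ 2 * (t + 1 : ℕ)) + 16 * ε / (1 - G.γ)) :=
        Finset.sum_le_sum fun t ht => R.gap_xhat_succ_le t.succ_pos
          ((Finset.mem_range.1 ht).trans_le hn) hw
    _ = (∑ t ∈ Finset.range n,
          (‖(R.xhat (t + 1) s).1 - w‖ ^ 2 - ‖(R.xhat (t + 2) s).1 - w‖ ^ 2)) / (2 * η) +
            24 / (η * (1 - G.γ) ^ 2) * harmonic n + 16 * ε / (1 - G.γ) * n := by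
        rw [Finset.sum_add_distrib, Finset.sum_add_distrib, hharmonic, Finset.sum_div,
          Finset.sum_const, Finset.card_range, nsmul_eq_mul, mul_comm (n : ℝ)]
    _ ≤ 2 / (2 * η) + 24 / (η * (1 - G.γ) ^ 2) * harmonic n + 16 * ε / (1 - G.γ) * n := by
        gcongr
    _ = 1 / η + 24 / (η * (1 - G.γ) ^ 2) * harmonic n + 16 * ε / (1 - G.γ) * n := by
        rw [← div_div, div_self two_ne_zero]

lemma sum_gap_xhat_le (s : S) (hT : 2 ≤ T) :
    ∑ t ∈ Finset.Icc 1 T, G.gap y s (R.xhat t s).1 ≤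
      76 / (η * (1 - G.γ) ^ 2) * Real.log T + 16 * ε / (1 - G.γ) * T := by
  obtain ⟨n, rfl⟩ := Nat.exists_eq_add_of_le' (one_le_two.trans hT)
  have hd := G.one_sub_γ_pos
  have hη := R.η_pos
  have hε := R.ε_nonneg
  set q := 1 / (η * (1 - G.γ) ^ 2) with hq
  have hq_pos : 0 < q := by positivity
  have hη_inv : 1 / η ≤ q := by
    refine one_div_le_one_div_of_le (by positivity) (mul_le_of_le_one_right hη.le ?_)
    exact pow_le_one₀ hd.le (sub_le_self 1 G.γ_nonneg)
  have hfirst : G.gap y s (R.xhat 1 s).1 ≤ q :=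
    (G.gap_le y (R.xhat 1 s).2 s).trans <|
      (one_div_le_one_div_of_le hη R.η_le_one_sub_γ).trans hη_inv
  have hsplit : ∑ t ∈ Finset.Icc 1 (n + 1), G.gap y s (R.xhat t s).1 =
      ∑ t ∈ Finset.range n, G.gap y s (R.xhat (t + 2) s).1 + G.gap y s (R.xhat 1 s).1 := by
    rw [← Finset.Ico_succ_right_eq_Icc, Finset.sum_Ico_eq_sum_range, Order.succ_eq_add_one,
      Nat.add_sub_cancel, Finset.sum_range_succ']
    simp only [add_comm 1, add_assoc, Nat.reduceAdd, zero_add]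
  have htail := R.sum_gap_xhat_add_two_le s n.le_succ
  have hεn : 16 * ε / (1 - G.γ) * n ≤ 16 * ε / (1 - G.γ) * (n + 1 : ℕ) := by
    gcongr
    exact n.le_succ
  have hq_log := mul_le_mul_of_nonneg_left
    (one_le_two_mul_log (x := (n + 1 : ℕ)) (mod_cast hT)) hq_pos.le
  have hq_harmonic := mul_le_mul_of_nonneg_left
    (harmonic_le_three_mul_log (Nat.le_of_succ_le_succ hT)) hq_pos.le
  rw [← mul_one_div 24, ← hq] at htail
  rw [hsplit, ← mul_one_div 76, ← hq]
  linarith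

lemma average_suboptimality_le_one_div :
    1 / (T : ℝ) * ∑ t ∈ Finset.Icc 1 T, G.suboptimality y (R.xhat t) ≤ 1 / (1 - G.γ) := by
  have hd := G.one_sub_γ_pos
  have hsum := Finset.sum_le_card_nsmul (Finset.Icc 1 T) _ _
    fun t _ => G.suboptimality_le_one_div y (R.xhat t)
  rw [Nat.card_Icc, Nat.add_sub_cancel, nsmul_eq_mul] at hsum
  rw [one_div_mul_eq_div]
  exact div_le_of_le_mul₀ T.cast_nonneg (by positivity) (by linarith)

lemma average_suboptimality_le_log_div (hT : 2 ≤ T) :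
    1 / (T : ℝ) * ∑ t ∈ Finset.Icc 1 T, G.suboptimality y (R.xhat t) ≤
      Fintype.card S / (1 - G.γ) *
        (76 / (η * (1 - G.γ) ^ 2) * (Real.log T / T) + 16 * ε / (1 - G.γ)) := by
  have hd := G.one_sub_γ_pos
  have : (0 : ℝ) < T := by positivity
  calc 1 / (T : ℝ) * ∑ t ∈ Finset.Icc 1 T, G.suboptimality y (R.xhat t)
      ≤ 1 / (T : ℝ) * ∑ t ∈ Finset.Icc 1 T, (∑ s, G.gap y s (R.xhat t s).1) / (1 - G.γ) := by
        gcongr with t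
        exact G.suboptimality_le_sum_gap y (R.xhat t)
    _ = 1 / (T : ℝ) * ((∑ s, ∑ t ∈ Finset.Icc 1 T, G.gap y s (R.xhat t s).1) / (1 - G.γ)) := by
        rw [← Finset.sum_div, Finset.sum_comm]
    _ ≤ 1 / (T : ℝ) * ((∑ _s : S,
          (76 / (η * (1 - G.γ) ^ 2) * Real.log T + 16 * ε / (1 - G.γ) * T)) / (1 - G.γ)) := by
        gcongr with s
        exact R.sum_gap_xhat_le s hT
    _ = Fintype.card S / (1 - G.γ) *
          (76 / (η * (1 - G.γ) ^ 2) * (Real.log T / T) + 16 * ε / (1 - G.γ)) := by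
        rw [Finset.sum_const, Finset.card_univ, nsmul_eq_mul]
        field

theorem average_suboptimality_le (hT : 2 ≤ T) :
    1 / (T : ℝ) * ∑ t ∈ Finset.Icc 1 T, G.suboptimality y (R.xhat t) ≤
      9 * (Fintype.card S / (η * (1 - G.γ) ^ 2) * √(Real.log T / T) +
        Fintype.card S * √ε / (√η * (1 - G.γ) ^ 2)) :=
  le_sqrt_add_sqrt_of_le_add (mod_cast R.card_pos) R.η_pos R.η_le_one G.one_sub_γ_pos
    (sub_le_self 1 G.γ_nonneg) (div_nonneg (Real.log_natCast_nonneg T) T.cast_nonneg) R.ε_nonneg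
    R.average_suboptimality_le_one_div (R.average_suboptimality_le_log_div hT)

end MarkovGame.SinglePlayerRun

/-! ### Last-iterate convergence -/

/- The critic error `a / t` delays the linear contraction: only the slower rate `1 / t` survives,
because `1 / t` itself shrinks by a factor `1 + κ / 2` per step only once `κ t ≥ 2`. -/
lemma le_div_add_of_contraction {κ a E : ℝ} {D : ℕ → ℝ} {T t : ℕ} (hκ : 0 < κ) (hκ₁ : κ ≤ 1)
    (ha : 0 ≤ a) (hE : 0 ≤ E) (hD : ∀ t, D t ≤ a)
    (hstep : ∀ t, 1 ≤ t → t < T → (1 + κ) * D (t + 1) ≤ D t + a / t + κ * E)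
    (ht₁ : 1 ≤ t) (ht : t ≤ T) : D t ≤ 4 * a / (κ * t) + E := by
  induction t, ht₁ using Nat.le_induction with
  | base =>
    have hbase : a ≤ 4 * a / (κ * (1 : ℕ)) := by
      rw [le_div_iff₀ (by positivity)]
      push_cast
      nlinarith
    linarith [hD 1]
  | succ t ht₁ ih =>
    have : (1 : ℝ) ≤ t := mod_cast ht₁
    push_cast
    rcases lt_or_ge (κ * t) 2 with hsmall | hlarge
    · have hinit : a ≤ 4 * a / (κ * (t + 1)) := by
        rw [le_div_iff₀ (by positivity)]
        nlinarith
      linarith [hD (t + 1)]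
    · have hrate : 4 * a / (κ * t) + a / t ≤ (1 + κ) * (4 * a / (κ * (t + 1))) := by
        have hleft : 4 * a / (κ * t) + a / t = a * (4 + κ) / (κ * t) := by field
        have hright : (1 + κ) * (4 * a / (κ * (t + 1))) = a * (4 * (1 + κ)) / (κ * (t + 1)) := by
          field
        rw [hleft, hright, div_le_div_iff₀ (by positivity) (by positivity)]
        have hgain : 0 ≤ a * κ * (3 * (κ * t) - 4 - κ) :=
          mul_nonneg (by positivity) (by linarith)
        linarith
      refine le_of_mul_le_mul_left ?_ (by linarith : 0 < 1 + κ)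
      linarith [hstep t ht₁ (by omega), ih (by omega)]

namespace MarkovGame.SinglePlayerRun

variable [Fintype S] [Fintype A] [Fintype B]
  {G : MarkovGame S A B} {y : Policy S B} {η ε C : ℝ} {T t : ℕ}

lemma infDist_xhat_le_two (R : G.SinglePlayerRun y η ε T) (t : ℕ) (s : S) :
    Metric.infDist (R.xhat t s).1 (G.bestResponsesAt y s) ≤ 2 := by
  have : Nonempty A := nonempty_of_mem_simplex (R.xhat t s).2
  obtain ⟨w, hw⟩ := G.bestResponsesAt_nonempty y s
  refine (Metric.infDist_le_dist_of_mem hw).trans ?_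
  rw [dist_eq_norm]
  exact norm_sub_le_two (R.xhat t s).2 ((G.mem_bestResponsesAt_iff y).1 hw).1

lemma sq_infDist_xhat_succ_le (R : G.SinglePlayerRun y η ε T) (hC₀ : 0 < C)
    (hC : G.IsErrorBoundConst y C) (ht₁ : 1 ≤ t) (ht : t ≤ T) (s : S) :
    (1 + η * C) * Metric.infDist (R.xhat (t + 1) s).1 (G.bestResponsesAt y s) ^ 2 ≤
      Metric.infDist (R.xhat t s).1 (G.bestResponsesAt y s) ^ 2 + 48 / (1 - G.γ) ^ 2 / t +
        η * C * (32 * ε / ((1 - G.γ) * C)) := by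
  have hd := G.one_sub_γ_pos
  have hη := R.η_pos
  have : (0 : ℝ) < t := mod_cast ht₁
  have : Nonempty A := nonempty_of_mem_simplex (R.xhat t s).2
  obtain ⟨w, hw⟩ := IsProj.exists_of_isCompact (G.isCompact_bestResponsesAt y s)
    (G.bestResponsesAt_nonempty y s) (R.xhat t s).1
  have hgap := R.gap_xhat_succ_le ht₁ ht hw.1
  rw [hw.norm_sub_eq_infDist] at hgap
  have herror := (G.isErrorBoundConst_iff y).1 hC s _ (R.xhat (t + 1) s).2
  have hdist : Metric.infDist (R.xhat (t + 1) s).1 (G.bestResponsesAt y s) ≤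
      ‖(R.xhat (t + 1) s).1 - w‖ := by
    rw [← dist_eq_norm]
    exact Metric.infDist_le_dist_of_mem hw.1
  have htwo := R.infDist_xhat_le_two (t + 1) s
  have hnonneg := Metric.infDist_nonneg (x := (R.xhat (t + 1) s).1) (s := G.bestResponsesAt y s)
  set D := Metric.infDist (R.xhat t s).1 (G.bestResponsesAt y s)
  set D' := Metric.infDist (R.xhat (t + 1) s).1 (G.bestResponsesAt y s)
  have hquad : C * D' ^ 2 ≤ 2 * (C * D') := by
    nlinarith [mul_nonneg (mul_nonneg hC₀.le hnonneg) (sub_nonneg.2 htwo)]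
  have hmul := mul_le_mul_of_nonneg_left
    (hquad.trans (mul_le_mul_of_nonneg_left (herror.trans hgap) zero_le_two)) hη.le
  calc (1 + η * C) * D' ^ 2 = D' ^ 2 + η * (C * D' ^ 2) := by ring
    _ ≤ ‖(R.xhat (t + 1) s).1 - w‖ ^ 2 + η * (2 * ((D ^ 2 - ‖(R.xhat (t + 1) s).1 - w‖ ^ 2) /
          (2 * η) + 24 / (η * (1 - G.γ) ^ 2 * t) + 16 * ε / (1 - G.γ))) := by gcongr
    _ = D ^ 2 + 48 / (1 - G.γ) ^ 2 / t + η * C * (32 * ε / ((1 - G.γ) * C)) := by field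

lemma η_mul_le_one (R : G.SinglePlayerRun y η ε T) (hC₀ : 0 ≤ C) (hC : C ≤ 1 / (1 - G.γ)) :
    η * C ≤ 1 :=
  calc η * C ≤ (1 - G.γ) * C := mul_le_mul_of_nonneg_right R.η_le_one_sub_γ hC₀
    _ ≤ 1 := (le_div_iff₀' G.one_sub_γ_pos).1 hC

lemma sq_infDist_xhat_le (R : G.SinglePlayerRun y η ε T) (hC₀ : 0 < C)
    (hC : G.IsErrorBoundConst y C) (hC_le : C ≤ 1 / (1 - G.γ)) (ht₁ : 1 ≤ t) (ht : t ≤ T) (s : S) :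
    Metric.infDist (R.xhat t s).1 (G.bestResponsesAt y s) ^ 2 ≤
      4 * (48 / (1 - G.γ) ^ 2) / (η * C * t) + 32 * ε / ((1 - G.γ) * C) := by
  have hd := G.one_sub_γ_pos
  have hη := R.η_pos
  have hε := R.ε_nonneg
  refine le_div_add_of_contraction
    (D := fun t => Metric.infDist (R.xhat t s).1 (G.bestResponsesAt y s) ^ 2)
    (by positivity) (R.η_mul_le_one hC₀.le hC_le) (by positivity) (by positivity)
    (fun t => ?_) (fun t ht₁ ht => R.sq_infDist_xhat_succ_le hC₀ hC ht₁ ht.le s) ht₁ ht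
  calc Metric.infDist (R.xhat t s).1 (G.bestResponsesAt y s) ^ 2 ≤ 2 ^ 2 :=
        pow_le_pow_left₀ Metric.infDist_nonneg (R.infDist_xhat_le_two t s) 2
    _ ≤ 48 / (1 - G.γ) ^ 2 := by
        rw [le_div_iff₀ (by positivity)]
        nlinarith [G.γ_nonneg]

lemma sq_infDist_xhat_final_le (R : G.SinglePlayerRun y η ε T) (hC₀ : 0 < C)
    (hC : G.IsErrorBoundConst y C) (hT : 1 ≤ T) (s : S) :
    Metric.infDist (R.xhat T s).1 (G.bestResponsesAt y s) ^ 2 ≤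
      192 * ((Fintype.card S : ℝ) ^ 2 / (η ^ 4 * C ^ 4 * (1 - G.γ) ^ 4 * T) +
        ε / (η * C ^ 2 * (1 - G.γ) ^ 3)) := by
  have hd := G.one_sub_γ_pos
  have hd₁ : 1 - G.γ ≤ 1 := sub_le_self 1 G.γ_nonneg
  have hη := R.η_pos
  have hε := R.ε_nonneg
  have : (0 : ℝ) < T := mod_cast hT
  rcases G.bestResponsesAt_eq_simplex_or_le y hC hC₀.le with htrivial | hC_le
  · rw [Metric.infDist_zero_of_mem ((htrivial s).ge (R.xhat T s).2), zero_pow two_ne_zero]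
    positivity
  have hκ := R.η_mul_le_one hC₀.le hC_le
  have hfactor₁ : (η * C) ^ 3 * (1 - G.γ) ^ 2 ≤ (Fintype.card S : ℝ) ^ 2 :=
    (mul_le_one₀ (pow_le_one₀ (by positivity) hκ) (by positivity) (pow_le_one₀ hd.le hd₁)).trans
      (one_le_pow₀ (mod_cast R.card_pos))
  have hfactor₂ : 32 * (η * C * (1 - G.γ) ^ 2) ≤ 192 := by
    linarith [mul_le_one₀ hκ (by positivity) (pow_le_one₀ hd.le hd₁ (n := 2))]
  calc Metric.infDist (R.xhat T s).1 (G.bestResponsesAt y s) ^ 2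
      ≤ 4 * (48 / (1 - G.γ) ^ 2) / (η * C * T) + 32 * ε / ((1 - G.γ) * C) :=
        R.sq_infDist_xhat_le hC₀ hC hC_le hT le_rfl s
    _ = 192 * ((η * C) ^ 3 * (1 - G.γ) ^ 2 / (η ^ 4 * C ^ 4 * (1 - G.γ) ^ 4 * T)) +
          32 * (η * C * (1 - G.γ) ^ 2) * (ε / (η * C ^ 2 * (1 - G.γ) ^ 3)) := by field
    _ ≤ 192 * ((Fintype.card S : ℝ) ^ 2 / (η ^ 4 * C ^ 4 * (1 - G.γ) ^ 4 * T)) +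
          192 * (ε / (η * C ^ 2 * (1 - G.γ) ^ 3)) := by gcongr
    _ = _ := (mul_add _ _ _).symm

theorem exists_proj_bestResponses (R : G.SinglePlayerRun y η ε T) (hC₀ : 0 < C)
    (hC : G.IsErrorBoundConst y C) (hT : 1 ≤ T) :
    ∃ xbar ∈ G.bestResponses y,
      (∀ s, IsProj (G.bestResponsesAt y s) (R.xhat T s).1 (xbar s).1) ∧
      1 / (Fintype.card S : ℝ) * ∑ s, ‖(R.xhat T s).1 - (xbar s).1‖ ^ 2 ≤
        192 * ((Fintype.card S : ℝ) ^ 2 / (η ^ 4 * C ^ 4 * (1 - G.γ) ^ 4 * T) +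
          ε / (η * C ^ 2 * (1 - G.γ) ^ 3)) := by
  have hproj (s : S) : ∃ w, IsProj (G.bestResponsesAt y s) (R.xhat T s).1 w := by
    have : Nonempty A := nonempty_of_mem_simplex (R.xhat T s).2
    exact IsProj.exists_of_isCompact (G.isCompact_bestResponsesAt y s)
      (G.bestResponsesAt_nonempty y s) _
  choose w hw using hproj
  have hbest (s : S) := (G.mem_bestResponsesAt_iff y).1 (hw s).1
  refine ⟨fun s => ⟨w s, (hbest s).1⟩, (G.mem_bestResponses_iff y).2 fun s => (hbest s).2, hw, ?_⟩
  have hcard : (0 : ℝ) < Fintype.card S := mod_cast R.card_pos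
  rw [one_div_mul_eq_div, div_le_iff₀' hcard, ← nsmul_eq_mul]
  refine Finset.sum_le_card_nsmul _ _ _ fun s _ => ?_
  rw [(hw s).norm_sub_eq_infDist]
  exact R.sq_infDist_xhat_final_le hC₀ hC hT s

end MarkovGame.SinglePlayerRun

end ZeroSum

end

theorem mainTheorem3 :
    ∃ K : ℝ, 0 < K ∧
      ∀ (S : Type u) (A : Type v) (B : Type w) [Fintype S] [Fintype A] [Fintype B]
        (G : ZeroSum.MarkovGame S A B) (y : ZeroSum.Policy S B),
        -- average suboptimality against `y`
        (∀ (η ε : ℝ) (T : ℕ) (R : G.SinglePlayerRun y η ε T), 2 ≤ T →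
          (1 / (T : ℝ)) * ∑ t ∈ Finset.Icc 1 T,
              (⨆ q : S × ZeroSum.Policy S A, (G.value (R.xhat t) y q.1 - G.value q.2 y q.1))
            ≤ K * ((Fintype.card S : ℝ) / (η * (1 - G.γ) ^ 2) * √(Real.log T / T)
                + (Fintype.card S : ℝ) * √ε / (√η * (1 - G.γ) ^ 2))) ∧
        -- last-iterate distance to the set of best responses
        (∃ C' : ℝ, 0 < C' ∧ G.IsErrorBoundConst y C') ∧
        (∀ C' : ℝ, 0 < C' → G.IsErrorBoundConst y C' →
          ∀ (η ε : ℝ) (T : ℕ) (R : G.SinglePlayerRun y η ε T), 1 ≤ T →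
            ∃ xbar ∈ G.bestResponses y,
              (∀ s, ZeroSum.IsProj (G.bestResponsesAt y s) (R.xhat T s).1 (xbar s).1) ∧
              (1 / (Fintype.card S : ℝ)) * ∑ s, ‖(R.xhat T s).1 - (xbar s).1‖ ^ 2
                ≤ K * ((Fintype.card S : ℝ) ^ 2 / (η ^ 4 * C' ^ 4 * (1 - G.γ) ^ 4 * T)
                    + ε / (η * C' ^ 2 * (1 - G.γ) ^ 3))) := by
  refine ⟨192, by norm_num, fun S A B _ _ _ G y => ⟨fun η ε T R hT => ?_, ?_, ?_⟩⟩
  · have hS := R.card_pos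
    have hη := R.η_pos
    have hd := G.one_sub_γ_pos
    exact (R.average_suboptimality_le hT).trans
      (mul_le_mul_of_nonneg_right (by norm_num) (by positivity))
  · exact G.exists_isErrorBoundConst y
  · intro C' hC₀ hC η ε T R hT
    exact R.exists_proj_bestResponses hC₀ hC hT
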